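/- Definitions. Let $(R,\mathfrak m,\Bbbk)$ be a Noetherian local domain of Krull dimension $d$ with fraction field $\mathbb F$. Fix $\mathbf a\in\mathbb R^d$ with coordinates linearly independent over $\mathbb Q$, and order $\mathbb Z^d$ by $\mathbf u\le\mathbf v$ if and only if $\langle\mathbf a,\mathbf u\rangle\le\langle\mathbf a,\mathbf v\rangle$. A valuation on $\mathbb F$ with value group $\mathbb Z^d$ is a surjective group homomorphism $\nu:\mathbb F^\times\to\mathbb Z^d$ with $\nu(x+y)\ge\min(\nu(x),\nu(y))$ whenever $x,y,x+y\ne 0$. For $\mathbf u\in\mathbb Z^d$ let $\mathbb F_{\ge\mathbf u}$ be the set consisting of $0$ and of all $x\in\mathbb F^\times$ with $\nu(x)\ge\mathbf u$; let $V=\mathbb F_{\ge\mathbf 0}$ be the valuation ring of $\nu$, with residue field $\Bbbk_V$. The valuation $\nu$ is OK relative to $R$ if 1. $R$ is a local subring of $V$ (that is, $R\subseteq V$ and $\mathfrak m=R\cap\mathfrak m_V$), and the induced extension of residue fields $\Bbbk\hookrightarrow\Bbbk_V$ is finite; 2. $\langle\mathbf a,\mathbf u\rangle>0$ for every nonzero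 $\mathbf u$ in the closed convex cone in $\mathbb R^d$ generated by $\nu(R\setminus\{0\})$; 3. there is $\mathbf v\in\mathbb Z^d$ such that $R\cap\mathbb F_{\ge n\mathbf v}\subseteq\mathfrak m^n$ for all integers $n\ge 0$. The local domain $R$ is OK if, for some such $\mathbf a$, there is a valuation on $\mathbb F$ with value group $\mathbb Z^d$ that is OK relative to $R$ (this forces $d\ge 1$). If $R$ has prime characteristic $p>0$, a $p$-family of ideals of $R$ is a sequence $I_\bullet=\{I_q\}$ of ideals, indexed by the powers $q=p^e$ ($e\ge 0$) of $p$, such that $I_q^{[p]}\subseteq I_{pq}$ for all $q$, where $I^{[p]}$ is the ideal generated by the $p$-th powers of the elements of $I$. It is $\mathfrak m$-primary if every $I_q$ is $\mathfrak m$-primary. Its volume is $$\operatorname{vol}_R(I_\bullet)=\lim_{q\to\infty}\frac{\ell_R(R/I_q)}{q^d},$$ where $q$ runs through the powers of $p$ and $\ell_R$ denotes length. Theorem. Let $(R,\mathfrak m)$ be a Noetherian OK local domain of dimension $d$ and of prime characteristic $p>0$, let $I_\bullet$ and $J_\bullet$ be $\mathfrak m$-primary $p$-families of ideals of $R$, and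 let $L_q=I_qJ_q$ for every power $q$ of $p$. Then $L_\bullet$ is an $\mathfrak m$-primary $p$-family, the limits $\operatorname{vol}_R(I_\bullet)$, $\operatorname{vol}_R(J_\bullet)$ and $\operatorname{vol}_R(L_\bullet)$ exist and are finite, and $$\operatorname{vol}_R(I_\bullet)^{1/d}+\operatorname{vol}_R(J_\bullet)^{1/d}\ \ge\ \operatorname{vol}_R(L_\bullet)^{1/d}.$$ -/

import Mathlib

open Filter Topology
open scoped NNReal ENNReal

section Valuations

/-- A valuation on the field `F` with value group `ℤ^d`. The linear order on `ℤ^d` is the one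
inherited from the embedding `u ↦ ⟨weight, u⟩` of `ℤ^d` into `ℝ` given by a vector `weight` of `ℝ^d`
whose coordinates are linearly independent over `ℚ`. -/
structure LatticeValuation (F : Type*) [Field F] (d : ℕ) where
  /-- the vector that induces the embedding of `ℤ^d` into `ℝ` -/
  weight : Fin d → ℝ
  linearIndependent_weight : LinearIndependent ℚ weight
  /-- the group homomorphism from the unit group of `F` to `ℤ^d` -/
  val : Additive Fˣ →+ (Fin d → ℤ)
  surjective_val : Function.Surjective val
  min_le_val_add : ∀ x y z : Fˣ, (z : F) = (x : F) + (y : F) →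
    min (weight ⬝ᵥ (fun i => (val (Additive.ofMul x) i : ℝ)))
        (weight ⬝ᵥ (fun i => (val (Additive.ofMul y) i : ℝ)))
      ≤ weight ⬝ᵥ (fun i => (val (Additive.ofMul z) i : ℝ))

namespace LatticeValuation

variable {F : Type*} [Field F] {d : ℕ} (ν : LatticeValuation F d)

/-- The embedding of `ℤ^d` into `ℝ` that defines the order on `ℤ^d`: `u ≤ v` in the order on `ℤ^d`
means `ν.emb u ≤ ν.emb v`. -/
noncomputable def emb (u : Fin d → ℤ) : ℝ := ν.weight ⬝ᵥ (fun i => (u i : ℝ))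

/-- The set consisting of `0` and of all nonzero `x` in `F` of value at least `u`. -/
def geSet (u : Fin d → ℤ) : Set F :=
  {x | ∀ h : x ≠ 0, ν.emb u ≤ ν.emb (ν.val (Additive.ofMul (Units.mk0 x h)))}

theorem emb_zero : ν.emb 0 = 0 := by
  simp [emb, dotProduct]

theorem emb_add (u v : Fin d → ℤ) : ν.emb (u + v) = ν.emb u + ν.emb v := by
  simp [emb, dotProduct, mul_add, Finset.sum_add_distrib]

theorem emb_neg (u : Fin d → ℤ) : ν.emb (-u) = -ν.emb u := by
  simp [emb, dotProduct]

theorem val_neg (x : Fˣ) : ν.val (Additive.ofMul (-x)) = ν.val (Additive.ofMul x) := by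
  have h1 : ν.val (Additive.ofMul (-1 : Fˣ)) = 0 := by
    have h2 : ν.val (Additive.ofMul (-1 : Fˣ)) + ν.val (Additive.ofMul (-1 : Fˣ)) = 0 := by
      rw [← map_add, ← ofMul_mul]
      simp
    funext i
    have h3 := congrFun h2 i
    simp only [Pi.add_apply, Pi.zero_apply] at h3 ⊢
    omega
  rw [← neg_one_mul, ofMul_mul, map_add, h1, zero_add]

/-- The valuation ring of `ν`: the elements of `F` that are zero or have nonnegative value. Its
maximal ideal consists of `0` and the elements of positive value. -/
noncomputable def valuationSubring : ValuationSubring F where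
  carrier := ν.geSet 0
  zero_mem' := fun h => absurd rfl h
  one_mem' := fun h => by
    have : Units.mk0 (1 : F) h = 1 := by ext; simp
    rw [this, ofMul_one, map_zero]
  mul_mem' := by
    intro x y hx hy h
    have hx0 : x ≠ 0 := left_ne_zero_of_mul h
    have hy0 : y ≠ 0 := right_ne_zero_of_mul h
    have h1 := hx hx0
    have h2 := hy hy0
    have h3 : Units.mk0 (x * y) h = Units.mk0 x hx0 * Units.mk0 y hy0 := by ext; simp
    rw [h3, ofMul_mul, map_add, emb_add]
    rw [emb_zero] at *
    linarith
  add_mem' := by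
    intro x y hx hy h
    by_cases hx0 : x = 0
    · subst hx0
      have h3 : (0 : F) + y = y := zero_add y
      simp only [h3] at h ⊢
      exact hy h
    by_cases hy0 : y = 0
    · subst hy0
      have h3 : x + (0 : F) = x := add_zero x
      simp only [h3] at h ⊢
      exact hx h
    exact le_trans (le_min (hx hx0) (hy hy0))
      (ν.min_le_val_add (Units.mk0 x hx0) (Units.mk0 y hy0) (Units.mk0 (x + y) h) (by simp))
  neg_mem' := by
    intro x hx h
    have hx0 : x ≠ 0 := neg_ne_zero.mp h
    have h3 : Units.mk0 (-x) h = -Units.mk0 x hx0 := by ext; simp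
    rw [h3, val_neg]
    exact hx hx0
  mem_or_inv_mem' := by
    intro x
    by_cases hx0 : x = 0
    · left
      exact fun h => absurd hx0 h
    rcases le_total 0 (ν.emb (ν.val (Additive.ofMul (Units.mk0 x hx0)))) with h | h
    · left
      intro _
      rw [emb_zero]
      exact h
    · right
      intro h4
      have h3 : Units.mk0 x⁻¹ h4 = (Units.mk0 x hx0)⁻¹ := by ext; simp
      rw [h3, ofMul_inv, map_neg, emb_neg, emb_zero]
      linarith

variable (D : Type*) [CommRing D] [Algebra D F]

/-- The semigroup `ν(D)` of the values of the nonzero elements of `D`, as a subset of `ℝ^d`. -/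
def valueSet : Set (Fin d → ℝ) :=
  {u | ∃ x : Fˣ, (x : F) ∈ Set.range (algebraMap D F) ∧
    u = fun i => (ν.val (Additive.ofMul x) i : ℝ)}

/-- The closed cone in `ℝ^d` generated by `ν(D)`: the closure of the set of all linear combinations
with nonnegative coefficients of elements of `ν(D)`. -/
def valueCone : Set (Fin d → ℝ) :=
  ((PointedCone.hull ℝ (ν.valueSet D)).closure : Set (Fin d → ℝ))

/-- The valuation `ν` on the fraction field `F` of the local domain `D` is OK relative to `D`
(to be used when `d` is the dimension of `D`). -/
structure IsOKRelativeTo [IsLocalRing D] : Prop where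
  /-- `D` is dominated by `ν`, that is, `D` is a local subring of the valuation ring `V` of `ν`, and
  the resulting extension of residue fields is finite. -/
  dominated_and_finite : ∃ h : ∀ x : D, algebraMap D F x ∈ ν.valuationSubring.toSubring,
    ∃ _ : IsLocalHom ((algebraMap D F).codRestrict ν.valuationSubring.toSubring h),
      RingHom.Finite (IsLocalRing.ResidueField.map (S := ν.valuationSubring)
        ((algebraMap D F).codRestrict ν.valuationSubring.toSubring h))
  /-- the closed cone generated by `ν(D)` is pointed by the order on `ℤ^d` (with domination, this is
  strong domination) -/
  pointed : ∀ u ∈ ν.valueCone D, u ≠ 0 → 0 < ν.weight ⬝ᵥ u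
  exists_forall_mem_pow : ∃ v : Fin d → ℤ, ∀ (n : ℕ) (x : D),
    algebraMap D F x ∈ ν.geSet (n • v) → x ∈ IsLocalRing.maximalIdeal D ^ n

end LatticeValuation

/-- A local domain is OK if, for `d` its (finite) Krull dimension, there is a valuation with value
group `ℤ^d` on its fraction field that is OK relative to it. -/
def IsOKLocalDomain (D : Type*) [CommRing D] [IsDomain D] [IsLocalRing D] : Prop :=
  ∃ d : ℕ, ringKrullDim D = d ∧
    ∃ ν : LatticeValuation (FractionRing D) d, ν.IsOKRelativeTo D

end Valuations

section PFamilies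

/-- A sequence of ideals `I_q`, indexed by the powers `q = p ^ e` (`e = 0, 1, 2, …`) of `p`, is a
`p`-family if `I_q^[p] ⊆ I_{pq}` for all `q`. Here `I e` stands for `I_{p ^ e}`, and the Frobenius
power `I_q^[p]` is the ideal generated by the `p`-th powers of the elements of `I_q`. -/
def IsPFamily {R : Type*} [CommRing R] (p : ℕ) (I : ℕ → Ideal R) : Prop :=
  ∀ e : ℕ, Ideal.span ((fun x : R => x ^ p) '' (I e : Set R)) ≤ I (e + 1)

/-- The ideal `I` is primary to the maximal ideal of the local ring `R`. -/
def IsMaximalIdealPrimary {R : Type*} [CommRing R] [IsLocalRing R] (I : Ideal R) : Prop :=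
  I.IsPrimary ∧ I.radical = IsLocalRing.maximalIdeal R

/-- The limit of `ℓ_R(R / I_q) / q ^ d`, as `q = p ^ e` tends to infinity, exists and is the
(finite) number `v`. For `d = dim R` this says that the volume of the sequence `I` exists and
is `v`. Lengths and limits are taken in `[0, ∞]`, so that no length is truncated. -/
def HasPVolume {R : Type*} [CommRing R] (p d : ℕ) (I : ℕ → Ideal R) (v : ℝ≥0) : Prop :=
  Tendsto (fun e : ℕ => ((Module.length R (R ⧸ I e) : ℕ∞) : ℝ≥0∞) / ((p : ℝ≥0∞) ^ e) ^ d)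
    atTop (𝓝 (v : ℝ≥0∞))

end PFamilies

/-! Filter `R` by value. Since the weights are rationally independent, a real value determines its
lattice point, so `R/I` is cut into pieces `gap h I u` indexed by the points `u` of `ν(R)`. Let `N`
be the length of the residue field of `V` over `R`, finite by condition 1. Every piece has length at
most `N`; for a fixed shift `w`, independent of `I` (`exists_shift`), it vanishes if `u - w ∈ ν(I)`
and equals `N` if `u - w ∈ ν(R)` but `u ∉ ν(I)`. So the length of `R/I_q` is `N` times the number of
points of `ν(R) \ ν(I_q)`, up to boundary effects.

Let `K` be the cone generated by `ν(R)`. Divided by `q`, the points of `ν(R)` fill the interior of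
`K`, and those of `ν(I_q)` fill the open body `B(I)`, the union of all `q⁻¹ ν(I_q) + int K`. Hence
the volume of `I` is `N` times that of `int K \ B(I)` (`tendsto_length_div`). Conditions 2 and 3
make this complement bounded.

From `ν(I_q) + ν(J_q) ⊆ ν(L_q)` and `p ν(I_q) ⊆ ν(I_{pq})` one gets `B(I) + B(J) ⊆ B(L)`. Bodies
absorb `K`, so the complements are star-shaped about the origin, and along each ray their radial
functions satisfy `r_L ≤ r_I + r_J`. As volume is `1/d` times the integral of `r^d` over the sphere,
Minkowski's inequality in `L^d` concludes (`measure_rpow_le_add_of_radial`). Convexity of the bodies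
is never needed. -/

/-! ### Polar coordinates and volumes of star-shaped sets. -/

section RadialSets

open MeasureTheory Set Metric

/-- A bounded lower subset of `(0, ∞)` is an interval up to its end point. -/
theorem exists_volumeIoiPow_eq_of_lower (n : ℕ) (T : Set (Ioi (0 : ℝ)))
    (hT : ∀ t ∈ T, ∀ s : Ioi (0 : ℝ), s ≤ t → s ∈ T) (hb : ∃ M : ℝ, ∀ t ∈ T, (t : ℝ) ≤ M) :
    ∃ a : ℝ, 0 ≤ a ∧ (∀ t : Ioi (0 : ℝ), (t : ℝ) < a → t ∈ T) ∧ (∀ t ∈ T, (t : ℝ) ≤ a) ∧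
      ((n + 1 : ℝ≥0∞) * Measure.volumeIoiPow n T) = ENNReal.ofReal a ^ (n + 1) := by
  obtain ⟨M, hM⟩ := hb
  rcases T.eq_empty_or_nonempty with rfl | ⟨t₀, ht₀⟩
  · refine ⟨0, le_rfl, fun t ht => absurd t.2 (not_lt.2 ht.le), by simp, by simp⟩
  set A : Set ℝ := (↑) '' T with hA
  have hAb : BddAbove A := ⟨M, by rintro _ ⟨t, ht, rfl⟩; exact hM t ht⟩
  have hle : ∀ t ∈ T, (t : ℝ) ≤ sSup A := fun t ht => le_csSup hAb ⟨t, ht, rfl⟩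
  have hpos : 0 < sSup A := lt_of_lt_of_le t₀.2 (hle t₀ ht₀)
  have hlt : ∀ t : Ioi (0 : ℝ), (t : ℝ) < sSup A → t ∈ T := by
    intro t ht
    obtain ⟨_, ⟨s, hs, rfl⟩, hts⟩ := exists_lt_of_lt_csSup (Set.Nonempty.image _ ⟨t₀, ht₀⟩) ht
    exact hT s hs t hts.le
  refine ⟨sSup A, hpos.le, hlt, hle, ?_⟩
  -- The end point may or may not belong to `T`, so it has to be a null set.
  have hnull : Measure.volumeIoiPow n {(⟨sSup A, hpos⟩ : Ioi (0 : ℝ))} = 0 := by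
    apply withDensity_absolutelyContinuous
    rw [comap_subtype_coe_apply measurableSet_Ioi]
    simp
  have hval : Measure.volumeIoiPow n T = Measure.volumeIoiPow n (Iio ⟨sSup A, hpos⟩) := by
    apply le_antisymm
    · calc Measure.volumeIoiPow n T
          ≤ Measure.volumeIoiPow n (Iio ⟨sSup A, hpos⟩ ∪ {⟨sSup A, hpos⟩}) := by
            apply measure_mono
            intro t ht
            rcases (hle t ht).lt_or_eq with h | h
            · exact Or.inl h
            · exact Or.inr (Subtype.ext h)
        _ ≤ _ := (measure_union_le _ _).trans (by rw [hnull, add_zero])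
    · exact measure_mono fun t ht => hlt t ht
  rw [hval, Measure.volumeIoiPow_apply_Iio, ← ENNReal.ofReal_pow hpos.le]
  have h1 : (n + 1 : ℝ≥0∞) = ENNReal.ofReal (n + 1) := by
    rw [ENNReal.ofReal_add (by positivity) (by positivity)]; simp
  rw [h1, ← ENNReal.ofReal_mul (by positivity)]
  congr 1
  field_simp

variable {E : Type*} [NormedAddCommGroup E] [NormedSpace ℝ E] [MeasurableSpace E] [BorelSpace E]
  [FiniteDimensional ℝ E] [Nontrivial E] (μ : Measure E) [μ.IsAddHaarMeasure]

/-- Polar coordinates live on the complement of the origin, which is a null set because `E` is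
nontrivial. -/
theorem measure_eq_lintegral_toSphere {D : Set E} (hD : MeasurableSet D) :
    μ D = ∫⁻ θ : sphere (0 : E) 1, Measure.volumeIoiPow (Module.finrank ℝ E - 1)
      {t | (t : ℝ) • (θ : E) ∈ D} ∂μ.toSphere := by
  have hp := μ.measurePreserving_homeomorphUnitSphereProd
  have hmeas : MeasurableSet
      {z : sphere (0 : E) 1 × Ioi (0 : ℝ) | (z.2 : ℝ) • (z.1 : E) ∈ D} := by
    have : Measurable fun z : sphere (0 : E) 1 × Ioi (0 : ℝ) => (z.2 : ℝ) • (z.1 : E) := by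
      fun_prop
    exact this hD
  have h1 := hp.measure_preimage hmeas.nullMeasurableSet
  rw [Measure.prod_apply hmeas] at h1
  have h2 : (homeomorphUnitSphereProd E) ⁻¹'
      {z : sphere (0 : E) 1 × Ioi (0 : ℝ) | (z.2 : ℝ) • (z.1 : E) ∈ D} = (↑) ⁻¹' D := by
    ext x
    have hx : ‖(x : E)‖ ≠ 0 := norm_ne_zero_iff.2 x.2
    simp [smul_smul, hx]
  rw [h2, comap_subtype_coe_apply (measurableSet_singleton _).compl] at h1
  have h3 : μ D = μ ((↑) '' (((↑) : ({0}ᶜ : Set E) → E) ⁻¹' D)) := by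
    rw [Subtype.image_preimage_coe, inter_comm, ← sdiff_eq, measure_sdiff_null (measure_singleton _)]
  rw [h3, h1]
  rfl

/-- The inequality of Brunn-Minkowski type for bounded sets that are star-shaped with respect to
the origin and whose radial functions satisfy `r_C ≤ r_A + r_B`. -/
theorem measure_rpow_le_add_of_radial {A B C : Set E} (hA : MeasurableSet A) (hB : MeasurableSet B)
    (hC : MeasurableSet C) (hAb : Bornology.IsBounded A) (hBb : Bornology.IsBounded B)
    (hCb : Bornology.IsBounded C)
    (hAs : ∀ x ∈ A, ∀ s : ℝ, 0 < s → s ≤ 1 → s • x ∈ A)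
    (hBs : ∀ x ∈ B, ∀ s : ℝ, 0 < s → s ≤ 1 → s • x ∈ B)
    (hCs : ∀ x ∈ C, ∀ s : ℝ, 0 < s → s ≤ 1 → s • x ∈ C)
    (hABC : ∀ x : E, ∀ s t : ℝ, 0 < s → 0 < t → (s + t) • x ∈ C → s • x ∈ A ∨ t • x ∈ B) :
    μ C ^ (1 / (Module.finrank ℝ E : ℝ)) ≤
      μ A ^ (1 / (Module.finrank ℝ E : ℝ)) + μ B ^ (1 / (Module.finrank ℝ E : ℝ)) := by
  obtain ⟨n, hn⟩ : ∃ n, Module.finrank ℝ E = n + 1 :=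
    ⟨_, (Nat.succ_pred_eq_of_pos Module.finrank_pos).symm⟩
  have hn0 : (n + 1 : ℝ≥0∞) ≠ 0 := by simp
  have hnt : (n + 1 : ℝ≥0∞) ≠ ∞ := by simp
  have hexp : (0 : ℝ) < 1 / ((n + 1 : ℕ) : ℝ) := by positivity
  -- `r` is the radial function of `D`. Defining it through the measure of the slice, rather than as
  -- a supremum, makes its measurability immediate.
  have key : ∀ D : Set E, MeasurableSet D → Bornology.IsBounded D →
      (∀ x ∈ D, ∀ s : ℝ, 0 < s → s ≤ 1 → s • x ∈ D) →
      ∃ r : sphere (0 : E) 1 → ℝ≥0∞, Measurable r ∧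
        (n + 1 : ℝ≥0∞) * μ D = ∫⁻ θ, r θ ^ ((n + 1 : ℕ) : ℝ) ∂μ.toSphere ∧
        ∀ θ, ∃ a : ℝ, 0 ≤ a ∧ r θ = ENNReal.ofReal a ∧
          (∀ t : ℝ, 0 < t → t < a → t • (θ : E) ∈ D) ∧
          (∀ t : ℝ, 0 < t → t • (θ : E) ∈ D → t ≤ a) := by
    intro D hD hDb hDs
    set f : sphere (0 : E) 1 → ℝ≥0∞ := fun θ =>
      Measure.volumeIoiPow n {t | (t : ℝ) • (θ : E) ∈ D} with hf
    have hfm : Measurable f := by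
      have hmeas : MeasurableSet
          {z : sphere (0 : E) 1 × Ioi (0 : ℝ) | (z.2 : ℝ) • (z.1 : E) ∈ D} := by
        have : Measurable fun z : sphere (0 : E) 1 × Ioi (0 : ℝ) => (z.2 : ℝ) • (z.1 : E) := by
          fun_prop
        exact this hD
      exact measurable_measure_prodMk_left hmeas
    refine ⟨fun θ => ((n + 1 : ℝ≥0∞) * f θ) ^ (1 / ((n + 1 : ℕ) : ℝ)), by fun_prop, ?_, ?_⟩
    · rw [measure_eq_lintegral_toSphere μ hD, hn, Nat.add_sub_cancel,
        ← lintegral_const_mul _ hfm]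
      congr 1 with θ
      rw [← ENNReal.rpow_mul, one_div_mul_cancel (by positivity), ENNReal.rpow_one]
    · intro θ
      obtain ⟨M, hM⟩ := hDb.exists_norm_le
      obtain ⟨a, ha, h1, h2, h3⟩ := exists_volumeIoiPow_eq_of_lower n
        {t : Ioi (0 : ℝ) | (t : ℝ) • (θ : E) ∈ D} (by
          intro t ht s hst
          have := hDs _ ht (s / t) (div_pos s.2 t.2) ((div_le_one t.2).2 hst)
          rw [smul_smul, div_mul_cancel₀ _ (ne_of_gt t.2)] at this
          exact this) ⟨M, by
          intro t ht
          have := hM _ ht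
          rwa [norm_smul, mem_sphere_zero_iff_norm.1 θ.2, mul_one,
            Real.norm_of_nonneg (le_of_lt t.2)] at this⟩
      refine ⟨a, ha, ?_, fun t ht hta => h1 ⟨t, ht⟩ hta, fun t ht htD => h2 ⟨t, ht⟩ htD⟩
      simp only [hf]
      rw [h3, ← ENNReal.rpow_natCast, ← ENNReal.rpow_mul, mul_one_div_cancel (by positivity),
        ENNReal.rpow_one]
  obtain ⟨rA, hrA, hrA1, hrA2⟩ := key A hA hAb hAs
  obtain ⟨rB, hrB, hrB1, hrB2⟩ := key B hB hBb hBs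
  obtain ⟨rC, hrC, hrC1, hrC2⟩ := key C hC hCb hCs
  have hle : ∀ θ, rC θ ≤ (rA + rB) θ := by
    intro θ
    obtain ⟨a, ha, ha1, ha2, ha3⟩ := hrA2 θ
    obtain ⟨b, hb, hb1, hb2, hb3⟩ := hrB2 θ
    obtain ⟨c, hc, hc1, hc2, hc3⟩ := hrC2 θ
    rw [Pi.add_apply, ha1, hb1, hc1, ← ENNReal.ofReal_add ha hb]
    apply ENNReal.ofReal_le_ofReal
    by_contra! hlt
    -- With a quarter of the defect, `(a + ε) + (b + ε) = c - 2ε` is still below `c`, while each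
    -- summand exceeds its own radius.
    set ε := (c - (a + b)) / 4 with hε
    have hε0 : 0 < ε := by simp only [hε]; linarith
    rcases hABC θ (a + ε) (b + ε) (by linarith) (by linarith)
      (hc2 _ (by linarith) (by linarith)) with h | h
    · linarith [ha3 _ (by linarith) h]
    · linarith [hb3 _ (by linarith) h]
  have hmink := ENNReal.lintegral_Lp_add_le (μ := μ.toSphere) hrA.aemeasurable hrB.aemeasurable
    (p := ((n + 1 : ℕ) : ℝ)) (by simp)
  rw [← hrA1, ← hrB1] at hmink
  have hmono : ((n + 1 : ℝ≥0∞) * μ C) ^ (1 / ((n + 1 : ℕ) : ℝ)) ≤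
      (∫⁻ θ, (rA + rB) θ ^ ((n + 1 : ℕ) : ℝ) ∂μ.toSphere) ^ (1 / ((n + 1 : ℕ) : ℝ)) := by
    rw [hrC1]
    gcongr with θ
    exact hle θ
  have h := hmono.trans hmink
  simp only [ENNReal.mul_rpow_of_nonneg _ _ hexp.le] at h
  rw [← mul_add] at h
  rw [hn]
  exact (ENNReal.mul_le_mul_iff_right (by simp)
    (ENNReal.rpow_ne_top_of_nonneg hexp.le hnt)).1 h

end RadialSets

/-! ### Lattice sums as integrals. -/

section LatticeSums

open MeasureTheory Set

variable {d : ℕ}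

/-- The fibres of the rounding map are cubes of side `1 / c`. This moves the sums for all scales to
one measure space, where dominated convergence applies. -/
theorem lintegral_floor_eq_tsum (c : ℝ) (hc : 0 < c) (G : (Fin d → ℤ) → ℝ≥0∞) :
    ∫⁻ x : Fin d → ℝ, G (fun i => ⌊c * x i⌋) = (∑' u, G u) / (ENNReal.ofReal c) ^ d := by
  have hφ : Measurable fun x : Fin d → ℝ => fun i => ⌊c * x i⌋ := by
    refine measurable_pi_lambda _ fun i => ?_
    exact Int.measurable_floor.comp (by fun_prop)
  rw [← lintegral_map (measurable_of_countable G) hφ, lintegral_countable', div_eq_mul_inv,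
    ← ENNReal.tsum_mul_right]
  congr 1 with u
  congr 1
  rw [Measure.map_apply hφ (measurableSet_singleton _)]
  have : (fun x : Fin d → ℝ => fun i => ⌊c * x i⌋) ⁻¹' {u} =
      Set.pi univ fun i => Ico ((u i : ℝ) / c) (((u i : ℝ) + 1) / c) := by
    ext x
    simp only [mem_preimage, mem_singleton_iff, funext_iff, Int.floor_eq_iff, Set.mem_pi, mem_univ,
      true_imp_iff, mem_Ico, div_le_iff₀ hc, lt_div_iff₀ hc, mul_comm c]
  rw [this, Real.volume_pi_Ico]
  have h2 : ∀ i, ((u i : ℝ) + 1) / c - (u i : ℝ) / c = c⁻¹ := fun i => by ring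
  simp only [h2, Finset.prod_const, Finset.card_univ, Fintype.card_fin]
  rw [ENNReal.ofReal_inv_of_pos hc, ENNReal.inv_pow]

theorem tendsto_floor_div (c : ℕ → ℝ) (hc : Tendsto c atTop atTop) (x : Fin d → ℝ) :
    Tendsto (fun n => (c n)⁻¹ • fun i => ((⌊c n * x i⌋ : ℤ) : ℝ)) atTop (𝓝 x) := by
  rw [tendsto_pi_nhds]
  intro i
  have h1 : Tendsto (fun n => x i - (c n)⁻¹) atTop (𝓝 (x i)) := by
    simpa using (tendsto_const_nhds (x := x i)).sub hc.inv_tendsto_atTop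
  refine tendsto_of_tendsto_of_tendsto_of_le_of_le' h1 tendsto_const_nhds ?_ ?_
  · filter_upwards [hc.eventually_gt_atTop 0] with n hn
    have := (Int.lt_floor_add_one (c n * x i)).le
    simp only [Pi.smul_apply, smul_eq_mul]
    rw [← div_eq_inv_mul, le_div_iff₀ hn, sub_mul, inv_mul_cancel₀ hn.ne']
    linarith
  · filter_upwards [hc.eventually_gt_atTop 0] with n hn
    have := Int.floor_le (c n * x i)
    simp only [Pi.smul_apply, smul_eq_mul]
    rw [← div_eq_inv_mul, div_le_iff₀ hn]
    linarith

/-- Normalized sums over the lattice converge to an integral. -/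
theorem tendsto_tsum_div_pow (c : ℕ → ℝ) (hc1 : ∀ n, 1 ≤ c n) (hc : Tendsto c atTop atTop)
    (G : ℕ → (Fin d → ℤ) → ℝ≥0∞) (N : ℝ≥0∞) (hN : N ≠ ∞) (hGN : ∀ n u, G n u ≤ N)
    (D : Set (Fin d → ℝ)) (hD : MeasurableSet D) (ρ : ℝ)
    (hρ : ∀ n u, G n u ≠ 0 → ‖(c n)⁻¹ • (fun i => (u i : ℝ))‖ ≤ ρ)
    (hlim : ∀ᵐ x : Fin d → ℝ, ∀ u : ℕ → Fin d → ℤ,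
      Tendsto (fun n => (c n)⁻¹ • fun i => (u n i : ℝ)) atTop (𝓝 x) →
        ∀ᶠ n in atTop, G n (u n) = D.indicator (fun _ => N) x) :
    Tendsto (fun n => (∑' u, G n u) / (ENNReal.ofReal (c n)) ^ d) atTop (𝓝 (N * volume D)) := by
  have hpos : ∀ n, 0 < c n := fun n => lt_of_lt_of_le one_pos (hc1 n)
  simp only [← lintegral_floor_eq_tsum _ (hpos _)]
  have hlimint : N * volume D = ∫⁻ x, D.indicator (fun _ => N) x := by
    rw [lintegral_indicator hD]; simp
  rw [hlimint]
  -- Rounding displaces a point by at most `1 / c n ≤ 1`, so every integrand vanishes outside the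
  -- ball of radius `ρ + 1`.
  refine tendsto_lintegral_of_dominated_convergence
    ((Metric.closedBall (0 : Fin d → ℝ) (ρ + 1)).indicator fun _ => N) ?_ ?_ ?_ ?_
  · intro n
    refine (measurable_of_countable (G n)).comp (measurable_pi_lambda _ fun i => ?_)
    exact Int.measurable_floor.comp (by fun_prop)
  · intro n
    refine Filter.Eventually.of_forall fun x => ?_
    by_cases hx : G n (fun i => ⌊c n * x i⌋) = 0
    · simp only [hx]; exact zero_le
    have h1 := hρ n _ hx
    have hmem : x ∈ Metric.closedBall (0 : Fin d → ℝ) (ρ + 1) := by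
      rw [mem_closedBall_zero_iff]
      have h2 : ‖x - (c n)⁻¹ • (fun i => ((⌊c n * x i⌋ : ℤ) : ℝ))‖ ≤ 1 := by
        rw [pi_norm_le_iff_of_nonneg zero_le_one]
        intro i
        have h3 : x i - (c n)⁻¹ * (⌊c n * x i⌋ : ℝ) = (c n)⁻¹ * Int.fract (c n * x i) := by
          have := (hpos n).ne'
          rw [← Int.self_sub_floor]; field_simp
        simp only [Pi.sub_apply, Pi.smul_apply, smul_eq_mul]
        rw [h3, Real.norm_of_nonneg (mul_nonneg (inv_nonneg.2 (hpos n).le) (Int.fract_nonneg _))]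
        exact mul_le_one₀ (inv_le_one_of_one_le₀ (hc1 n)) (Int.fract_nonneg _)
          (Int.fract_lt_one _).le
      calc ‖x‖ = ‖(c n)⁻¹ • (fun i => ((⌊c n * x i⌋ : ℤ) : ℝ)) +
            (x - (c n)⁻¹ • (fun i => ((⌊c n * x i⌋ : ℤ) : ℝ)))‖ := by congr 1; abel
        _ ≤ ρ + 1 := (norm_add_le _ _).trans (add_le_add h1 h2)
    simp only [Set.indicator_of_mem hmem]
    exact hGN n _
  · rw [lintegral_indicator Metric.isClosed_closedBall.measurableSet]
    simp only [lintegral_const, Measure.restrict_apply MeasurableSet.univ, univ_inter]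
    exact ENNReal.mul_ne_top hN measure_closedBall_lt_top.ne
  · filter_upwards [hlim] with x hx
    exact tendsto_const_nhds.congr' ((hx _ (tendsto_floor_div c hc x)).mono fun n hn => hn.symm)

end LatticeSums

/-! ### Boundaries of sets that absorb an open cone. -/

section UpperSets

open MeasureTheory Set
open scoped Pointwise

/-- The open set `x + c - C` contains `x`, so it meets `U` in some `y`, and `x + c` lies in `y + C`.
-/
theorem closure_add_subset_of_isOpen {E : Type*} [NormedAddCommGroup E] {U C : Set E} (hC : IsOpen C)
    (hUC : ∀ x ∈ U, ∀ c ∈ C, x + c ∈ U) : ∀ x ∈ closure U, ∀ c ∈ C, x + c ∈ U := by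
  intro x hx c hc
  have hopen : IsOpen ((fun y => x + c - y) ⁻¹' C) := hC.preimage (by fun_prop)
  obtain ⟨y, hy, hyU⟩ := mem_closure_iff.1 hx _ hopen (by simpa using hc)
  simpa using hUC y hyU _ hy

/-- Moving a point of the closure by a positive multiple of `c ∈ C` lands in `U`. Hence the
translates of the boundary by distinct multiples of `c` are disjoint; infinitely many of them with
bounded shifts force measure zero. -/
theorem measure_closure_diff_inter_eq_zero {E : Type*} [NormedAddCommGroup E]
    [NormedSpace ℝ E] [MeasurableSpace E] [BorelSpace E]
    [FiniteDimensional ℝ E] (μ : Measure E) [μ.IsAddHaarMeasure] {U C : Set E} (hU : IsOpen U)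
    (hC : IsOpen C) (hCs : ∀ x ∈ C, ∀ t : ℝ, 0 < t → t • x ∈ C)
    (hUC : ∀ x ∈ U, ∀ c ∈ C, x + c ∈ U) : μ ((closure U \ U) ∩ C) = 0 := by
  rcases C.eq_empty_or_nonempty with rfl | ⟨c, hc⟩
  · simp
  have hcl := closure_add_subset_of_isOpen hC hUC
  have hdisj : ∀ m n : ℕ, m < n → Disjoint ({((m : ℝ) + 1)⁻¹ • c} + (closure U \ U) ∩ C)
      ({((n : ℝ) + 1)⁻¹ • c} + (closure U \ U) ∩ C) := by
    intro m n hmn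
    rw [Set.disjoint_left]
    rintro y ⟨_, rfl, a, ha, rfl⟩ ⟨_, rfl, b, hb, hab⟩
    have hlt : ((n : ℝ) + 1)⁻¹ < ((m : ℝ) + 1)⁻¹ := by
      have : (m : ℝ) < n := by exact_mod_cast hmn
      gcongr
    have : b = a + (((m : ℝ) + 1)⁻¹ - ((n : ℝ) + 1)⁻¹) • c := by
      rw [sub_smul, eq_comm, ← sub_eq_zero]
      simp only at hab
      rw [← sub_eq_zero] at hab
      rw [← neg_eq_zero, ← hab]; abel
    exact hb.1.2 (this ▸ hcl a ha.1.1 _ (hCs c hc _ (sub_pos.2 hlt)))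
  refine Measure.addHaar_eq_zero_of_disjoint_translates μ (fun n : ℕ => ((n : ℝ) + 1)⁻¹ • c) ?_ ?_
    (((isClosed_closure.measurableSet).diff hU.measurableSet).inter hC.measurableSet)
  · rw [isBounded_iff_forall_norm_le]
    refine ⟨‖c‖, ?_⟩
    rintro _ ⟨n, rfl⟩
    rw [norm_smul, Real.norm_of_nonneg (by positivity)]
    exact mul_le_of_le_one_left (norm_nonneg _) (inv_le_one_of_one_le₀ (by simp))
  · intro m n hmn
    rcases hmn.lt_or_gt with h | h
    · exact hdisj m n h
    · exact (hdisj n m h).symm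

end UpperSets

/-! ### Lattice points of semigroups near interior rays. -/

section LatticeSemigroups

variable {d : ℕ}

/-- The inclusion of `ℤ^d` into `ℝ^d`. -/
def latticeCast (d : ℕ) : (Fin d → ℤ) →+ (Fin d → ℝ) where
  toFun u i := u i
  map_zero' := by ext; simp
  map_add' u v := by ext; simp

@[simp] theorem latticeCast_apply (u : Fin d → ℤ) (i : Fin d) :
    latticeCast d u i = (u i : ℝ) := rfl

theorem latticeCast_zsmul (m : ℤ) (u : Fin d → ℤ) :
    latticeCast d (m • u) = (m : ℝ) • latticeCast d u := by
  ext i; simp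

theorem latticeCast_injective : Function.Injective (latticeCast d) := fun u v h => by
  ext i
  simpa using congrFun h i

theorem finite_norm_latticeCast_le (ρ : ℝ) : {u : Fin d → ℤ | ‖latticeCast d u‖ ≤ ρ}.Finite := by
  refine Set.Finite.subset (Set.Finite.pi' fun _ : Fin d => Set.finite_Icc (-⌈ρ⌉) ⌈ρ⌉) ?_
  intro u hu i
  have h1 : |(u i : ℝ)| ≤ ρ := (norm_le_pi_norm (latticeCast d u) i).trans hu
  have h2 : |(u i : ℝ)| ≤ ⌈ρ⌉ := h1.trans (Int.le_ceil _)
  have h3 : |u i| ≤ ⌈ρ⌉ := by exact_mod_cast h2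
  exact abs_le.1 h3

theorem eq_sum_smul_single (y : Fin d → ℝ) :
    y = ∑ j, y j • latticeCast d (Pi.single j 1) := by
  ext i
  simp [Finset.sum_apply, Pi.single_apply]

/-- The semigroup itself need not be finitely generated; finitely many of its elements suffice to
express the unit vectors with integer coefficients. -/
theorem exists_generators (S : AddSubmonoid (Fin d → ℤ))
    (hS : AddSubgroup.closure (S : Set (Fin d → ℤ)) = ⊤) :
    ∃ (A : Finset (Fin d → ℤ)) (c : Fin d → (Fin d → ℤ) →₀ ℤ), (A : Set (Fin d → ℤ)) ⊆ S ∧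
      ∀ j, (c j).support ⊆ A ∧ (c j).sum (fun s m => m • s) = Pi.single j 1 := by
  classical
  have hspan : Submodule.span ℤ (S : Set (Fin d → ℤ)) = ⊤ := by
    rw [← Submodule.toAddSubgroup_inj, Submodule.span_int_eq_addSubgroupClosure, hS]
    rfl
  have h1 : ∀ j : Fin d, ∃ c : (Fin d → ℤ) →₀ ℤ, (c.support : Set (Fin d → ℤ)) ⊆ S ∧
      c.sum (fun s m => m • s) = Pi.single j 1 := fun j =>
    Submodule.mem_span_set.1 (hspan ▸ Submodule.mem_top)
  choose c hc1 hc2 using h1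
  refine ⟨Finset.univ.biUnion fun j => (c j).support, c, ?_, fun j => ⟨?_, hc2 j⟩⟩
  · intro s hs
    simp only [Finset.coe_biUnion, Set.mem_iUnion] at hs
    obtain ⟨j, -, hj⟩ := hs
    exact hc1 j hj
  · exact Finset.subset_biUnion_of_mem (fun j => (c j).support) (Finset.mem_univ j)

/-- A semigroup in `ℤ^d` that generates `ℤ^d` as a group contains all large lattice points close to
a ray through the interior of the cone it generates. -/
theorem eventually_mem_of_tendsto_interior (S : AddSubmonoid (Fin d → ℤ))
    (hS : AddSubgroup.closure (S : Set (Fin d → ℤ)) = ⊤) (x : Fin d → ℝ)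
    (hx : x ∈ interior (PointedCone.hull ℝ (latticeCast d '' S) : Set (Fin d → ℝ)))
    (c : ℕ → ℝ) (hc : Tendsto c atTop atTop) (u : ℕ → Fin d → ℤ)
    (hu : Tendsto (fun n => (c n)⁻¹ • latticeCast d (u n)) atTop (𝓝 x)) :
    ∀ᶠ n in atTop, u n ∈ S := by
  classical
  obtain ⟨A₀, m, hA₀, hm⟩ := exists_generators S hS
  -- Setting aside a small multiple of every element of `A₀` leaves a point of the cone, so `x`
  -- becomes a combination of elements of `S` with strictly positive coefficients.
  obtain ⟨δ, hδ, hδx⟩ : ∃ δ : ℝ, 0 < δ ∧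
      x - δ • ∑ s ∈ A₀, latticeCast d s ∈ PointedCone.hull ℝ (latticeCast d '' S) := by
    have h1 : Tendsto (fun δ : ℝ => x - δ • ∑ s ∈ A₀, latticeCast d s) (𝓝[>] 0) (𝓝 x) := by
      have : Continuous fun δ : ℝ => x - δ • ∑ s ∈ A₀, latticeCast d s := by fun_prop
      simpa using (this.tendsto 0).mono_left nhdsWithin_le_nhds
    obtain ⟨δ, h2, h3⟩ := ((h1.eventually (mem_interior_iff_mem_nhds.1 hx)).and
      self_mem_nhdsWithin).exists
    exact ⟨δ, h3, h2⟩
  obtain ⟨l, hl, hlx⟩ := (Finsupp.mem_span_image_iff_linearCombination {r : ℝ // 0 ≤ r}).1 hδx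
  set A : Finset (Fin d → ℤ) := A₀ ∪ l.support with hA
  have hAS : ∀ s ∈ A, s ∈ S := by
    intro s hs
    rcases Finset.mem_union.1 hs with h | h
    · exact hA₀ h
    · exact hl h
  set lam : (Fin d → ℤ) → ℝ := fun s => (l s : ℝ) + if s ∈ A₀ then δ else 0 with hlam
  have hlam_pos : ∀ s ∈ A, 0 < lam s := by
    intro s hs
    by_cases h : s ∈ A₀
    · simp only [hlam, if_pos h]
      have := (l s).2
      positivity
    · have h1 : l s ≠ 0 := Finsupp.mem_support_iff.1 ((Finset.mem_union.1 hs).resolve_left h)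
      simp only [hlam, if_neg h, add_zero]
      exact lt_of_le_of_ne (l s).2 fun h2 => h1 (Subtype.ext h2.symm)
  have hxsum : x = ∑ s ∈ A, lam s • latticeCast d s := by
    simp only [hlam, add_smul, Finset.sum_add_distrib, ite_smul, zero_smul]
    rw [Finset.sum_ite_mem, Finset.inter_eq_right.2 Finset.subset_union_left, ← Finset.smul_sum,
      ← sub_eq_iff_eq_add, ← hlx, Finsupp.linearCombination_apply,
      Finsupp.sum_of_support_subset _ (Finset.subset_union_right : l.support ⊆ A) _ (by simp)]
    rfl
  have hsingle : ∀ j, ∑ s ∈ A, m j s • s = Pi.single j 1 := by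
    intro j
    rw [← (hm j).2, Finsupp.sum_of_support_subset _
      ((hm j).1.trans Finset.subset_union_left : (m j).support ⊆ A) _ (by simp)]
  have hsingleR : ∀ j, latticeCast d (Pi.single j 1) = ∑ s ∈ A, (m j s : ℝ) • latticeCast d s := by
    intro j
    rw [← hsingle, map_sum]
    simp only [latticeCast_zsmul]
  set y : ℕ → Fin d → ℝ := fun n => (c n)⁻¹ • latticeCast d (u n) - x with hy
  have hy0 : Tendsto y atTop (𝓝 0) := by simpa using hu.sub (tendsto_const_nhds (x := x))
  -- Real coefficients of `u n` on `A`; they grow linearly in `c n` because `y n` tends to zero and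
  -- `lam` is positive.
  set β : ℕ → (Fin d → ℤ) → ℝ := fun n s => c n * (lam s + ∑ j, y n j * m j s) with hβ
  have hβsum : ∀ n, c n ≠ 0 → latticeCast d (u n) = ∑ s ∈ A, β n s • latticeCast d s := by
    intro n hn
    have h1 : latticeCast d (u n) = c n • (x + y n) := by
      simp only [hy, add_sub_cancel, smul_smul, mul_inv_cancel₀ hn, one_smul]
    have h2 : y n = ∑ s ∈ A, (∑ j, y n j * m j s) • latticeCast d s := by
      conv_lhs => rw [eq_sum_smul_single (y n)]
      simp only [hsingleR, Finset.smul_sum, smul_smul, Finset.sum_smul]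
      rw [Finset.sum_comm]
    rw [h1, h2, hxsum, ← Finset.sum_add_distrib, Finset.smul_sum]
    refine Finset.sum_congr rfl fun s _ => ?_
    rw [← add_smul, smul_smul]
  set B : ℝ := ∑ s ∈ A, ‖latticeCast d s‖ with hB
  set K : (Fin d → ℤ) → ℝ := fun s => ∑ j, B * |(m j s : ℝ)| with hK
  have hlarge : ∀ s ∈ A, ∀ᶠ n in atTop, 1 + K s ≤ β n s := by
    intro s hs
    have h1 : Tendsto (fun n => lam s + ∑ j, y n j * m j s) atTop (𝓝 (lam s)) := by
      have : Tendsto (fun n => lam s + ∑ j, y n j * m j s) atTop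
          (𝓝 (lam s + ∑ j, (0 : Fin d → ℝ) j * m j s)) :=
        tendsto_const_nhds.add (tendsto_finsetSum _ fun j _ =>
          ((tendsto_pi_nhds.1 hy0) j).mul_const _)
      simpa using this
    exact (hc.atTop_mul_pos (hlam_pos s hs) h1).eventually_ge_atTop _
  have hlarge' := (Filter.eventually_all_finset A).2 hlarge
  filter_upwards [hlarge', hc.eventually_gt_atTop 0] with n hn hcn
  -- The remainder after rounding the coefficients down is a lattice vector of norm at most `B`.
  -- Rewritten through the unit vectors it has integer coefficients bounded by `K`, which the large
  -- floors absorb.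
  set r : Fin d → ℤ := u n - ∑ s ∈ A, ⌊β n s⌋ • s with hr
  have hrR : latticeCast d r = ∑ s ∈ A, Int.fract (β n s) • latticeCast d s := by
    rw [hr, map_sub, map_sum, hβsum n hcn.ne', ← Finset.sum_sub_distrib]
    refine Finset.sum_congr rfl fun s _ => ?_
    rw [latticeCast_zsmul, ← sub_smul, Int.self_sub_floor]
  have hrB : ‖latticeCast d r‖ ≤ B := by
    rw [hrR]
    refine (norm_sum_le _ _).trans (Finset.sum_le_sum fun s _ => ?_)
    rw [norm_smul, Real.norm_of_nonneg (Int.fract_nonneg _)]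
    exact mul_le_of_le_one_left (norm_nonneg _) (Int.fract_lt_one _).le
  have hrj : ∀ j, |(r j : ℝ)| ≤ B := fun j => (norm_le_pi_norm (latticeCast d r) j).trans hrB
  have hrsum : r = ∑ s ∈ A, (∑ j, r j * m j s) • s := by
    apply latticeCast_injective
    rw [eq_sum_smul_single (latticeCast d r), map_sum]
    simp only [hsingleR, Finset.smul_sum, smul_smul, latticeCast_apply]
    rw [Finset.sum_comm]
    refine Finset.sum_congr rfl fun s _ => ?_
    rw [latticeCast_zsmul, Int.cast_sum, Finset.sum_smul]
    simp only [Int.cast_mul]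
  have husum : u n = ∑ s ∈ A, (⌊β n s⌋ + ∑ j, r j * m j s) • s := by
    simp only [add_smul, Finset.sum_add_distrib]
    rw [← hrsum, hr]; abel
  rw [husum]
  refine sum_mem fun s hs => ?_
  have hnn : 0 ≤ ⌊β n s⌋ + ∑ j, r j * m j s := by
    have h1 : β n s - 1 < ⌊β n s⌋ := Int.sub_one_lt_floor _
    have h2 : |∑ j, (r j : ℝ) * m j s| ≤ K s := by
      refine (Finset.abs_sum_le_sum_abs _ _).trans (Finset.sum_le_sum fun j _ => ?_)
      rw [abs_mul]
      exact mul_le_mul_of_nonneg_right (hrj j) (abs_nonneg _)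
    have h3 := neg_le_of_abs_le h2
    have h4 := hn s hs
    have h5 : (0 : ℝ) ≤ (⌊β n s⌋ : ℝ) + ∑ j, (r j : ℝ) * m j s := by linarith
    exact_mod_cast h5
  obtain ⟨k, hk⟩ := Int.eq_ofNat_of_zero_le hnn
  rw [hk, natCast_zsmul]
  exact nsmul_mem (hAS s hs) k

end LatticeSemigroups

/-! ### Closed cones and linear growth. -/

section Cones

variable {E : Type*} [NormedAddCommGroup E] [NormedSpace ℝ E]

theorem PointedCone.add_mem_interior (K : PointedCone ℝ E) {x y : E}
    (hx : x ∈ interior (K : Set E)) (hy : y ∈ K) : x + y ∈ interior (K : Set E) := by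
  have hopen : IsOpen ((fun z => z - y) ⁻¹' interior (K : Set E)) :=
    isOpen_interior.preimage (by fun_prop)
  refine mem_interior.2 ⟨_, ?_, hopen, by simpa using hx⟩
  intro z hz
  have := K.add_mem (interior_subset hz) hy
  simpa using this

theorem PointedCone.smul_mem_interior (K : PointedCone ℝ E) {x : E}
    (hx : x ∈ interior (K : Set E)) {t : ℝ} (ht : 0 < t) : t • x ∈ interior (K : Set E) := by
  have hopen : IsOpen ((fun z => t⁻¹ • z) ⁻¹' interior (K : Set E)) :=
    isOpen_interior.preimage (by fun_prop)
  refine mem_interior.2 ⟨_, ?_, hopen, by simpa [smul_smul, ht.ne'] using hx⟩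
  intro z hz
  have := K.smul_mem ht.le (interior_subset hz)
  simpa [smul_smul, ht.ne'] using this

/-- By compactness `f` has a positive minimum on the unit vectors of `K`; `κ` is its inverse, or
zero if there are no such vectors. -/
theorem PointedCone.exists_norm_le_mul [FiniteDimensional ℝ E] (K : PointedCone ℝ E)
    (hK : IsClosed (K : Set E)) (f : E → ℝ) (hf : Continuous f)
    (hfs : ∀ (t : ℝ) (x : E), f (t • x) = t * f x) (hpos : ∀ x ∈ K, x ≠ 0 → 0 < f x) :
    ∃ κ : ℝ, 0 ≤ κ ∧ ∀ x ∈ K, ‖x‖ ≤ κ * f x := by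
  have hf0 : f 0 = 0 := by simpa using hfs 0 0
  have hcomp : IsCompact (Metric.sphere (0 : E) 1 ∩ K) := (isCompact_sphere 0 1).inter_right hK
  have hnormalize : ∀ x ∈ K, x ≠ 0 → ‖x‖⁻¹ • x ∈ Metric.sphere (0 : E) 1 ∩ K := by
    intro x hx hx0
    exact ⟨by simp [norm_smul, hx0], K.smul_mem (inv_nonneg.2 (norm_nonneg _)) hx⟩
  rcases (Metric.sphere (0 : E) 1 ∩ (K : Set E)).eq_empty_or_nonempty with h | h
  · refine ⟨0, le_rfl, fun x hx => ?_⟩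
    by_contra hlt
    have hx0 : x ≠ 0 := fun h0 => hlt (by simp [h0])
    have := hnormalize x hx hx0
    rw [h] at this
    exact this
  · obtain ⟨y, hy, hmin⟩ := hcomp.exists_isMinOn h hf.continuousOn
    have hy0 : y ≠ 0 := fun h0 => by simpa [h0] using hy.1
    have hfy := hpos y hy.2 hy0
    refine ⟨(f y)⁻¹, (inv_pos.2 hfy).le, fun x hx => ?_⟩
    by_cases hx0 : x = 0
    · simp [hx0, hf0]
    have h1 : f y ≤ f (‖x‖⁻¹ • x) := hmin (hnormalize x hx hx0)
    rw [hfs, ← div_eq_inv_mul, le_div_iff₀ (norm_pos_iff.2 hx0)] at h1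
    rwa [← div_eq_inv_mul, le_div_iff₀ hfy, mul_comm]

end Cones

/-! ### The body of a `p`-family, and counting points outside it. -/

section PBodies

open MeasureTheory

variable {d : ℕ}

/-- The open body attached to a sequence of subsets `T e` of `ℤ^d`: the union of the translates
of the interior of `K` by the points of `p^(-e) T e`. -/
def pBody (K : PointedCone ℝ (Fin d → ℝ)) (p : ℕ) (T : ℕ → Set (Fin d → ℤ)) :
    Set (Fin d → ℝ) :=
  ⋃ e, ⋃ t ∈ T e, {x | x - ((p : ℝ) ^ e)⁻¹ • latticeCast d t ∈ interior (K : Set (Fin d → ℝ))}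

theorem mem_pBody {K : PointedCone ℝ (Fin d → ℝ)} {p : ℕ} {T : ℕ → Set (Fin d → ℤ)}
    {x : Fin d → ℝ} : x ∈ pBody K p T ↔
      ∃ e, ∃ t ∈ T e, x - ((p : ℝ) ^ e)⁻¹ • latticeCast d t ∈ interior (K : Set (Fin d → ℝ)) := by
  simp [pBody]

/-- The complement of the body in the interior of the cone. -/
def pCobody (K : PointedCone ℝ (Fin d → ℝ)) (p : ℕ) (T : ℕ → Set (Fin d → ℤ)) :
    Set (Fin d → ℝ) :=
  interior (K : Set (Fin d → ℝ)) \ pBody K p T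

theorem isOpen_pBody (K : PointedCone ℝ (Fin d → ℝ)) (p : ℕ) (T : ℕ → Set (Fin d → ℤ)) :
    IsOpen (pBody K p T) :=
  isOpen_iUnion fun _ => isOpen_biUnion fun _ _ => isOpen_interior.preimage (by fun_prop)

theorem measurableSet_pCobody (K : PointedCone ℝ (Fin d → ℝ)) (p : ℕ)
    (T : ℕ → Set (Fin d → ℤ)) : MeasurableSet (pCobody K p T) :=
  isOpen_interior.measurableSet.diff (isOpen_pBody K p T).measurableSet

theorem add_mem_pBody {K : PointedCone ℝ (Fin d → ℝ)} {p : ℕ} {T : ℕ → Set (Fin d → ℤ)}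
    {x : Fin d → ℝ} (hx : x ∈ pBody K p T) {y : Fin d → ℝ} (hy : y ∈ K) :
    x + y ∈ pBody K p T := by
  obtain ⟨e, t, ht, h⟩ := mem_pBody.1 hx
  refine mem_pBody.2 ⟨e, t, ht, ?_⟩
  rw [add_sub_right_comm]
  exact K.add_mem_interior h hy

/-- If `s • x` were in the body, adding `(1 - s) • x ∈ K` would put `x` there too. -/
theorem smul_mem_pCobody {K : PointedCone ℝ (Fin d → ℝ)} {p : ℕ} {T : ℕ → Set (Fin d → ℤ)}
    {x : Fin d → ℝ} (hx : x ∈ pCobody K p T) {s : ℝ} (hs : 0 < s) (hs1 : s ≤ 1) :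
    s • x ∈ pCobody K p T := by
  refine ⟨K.smul_mem_interior hx.1 hs, fun h => hx.2 ?_⟩
  have := add_mem_pBody h (K.smul_mem (sub_nonneg.2 hs1) (interior_subset hx.1))
  rwa [← add_smul, add_sub_cancel, one_smul] at this

/-- If `p T e ⊆ T (e + 1)` then `p^k T e ⊆ T (e + k)`. -/
theorem pow_nsmul_mem {p : ℕ} {T : ℕ → Set (Fin d → ℤ)} (hT : ∀ e, ∀ t ∈ T e, p • t ∈ T (e + 1))
    {e : ℕ} {t : Fin d → ℤ} (ht : t ∈ T e) (k : ℕ) : p ^ k • t ∈ T (e + k) := by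
  induction k with
  | zero => simpa using ht
  | succ k ih => rw [pow_succ', mul_smul, ← add_assoc]; exact hT _ _ ih

theorem inv_pow_smul_latticeCast_pow_nsmul {p : ℕ} (hp : p ≠ 0) (e k : ℕ) (t : Fin d → ℤ) :
    ((p : ℝ) ^ (e + k))⁻¹ • latticeCast d (p ^ k • t) = ((p : ℝ) ^ e)⁻¹ • latticeCast d t := by
  have h : (p : ℝ) ≠ 0 := by exact_mod_cast hp
  rw [map_nsmul, ← Nat.cast_smul_eq_nsmul ℝ, smul_smul]
  congr 1
  push_cast
  rw [pow_add]
  field_simp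

/-- Points at levels `e` and `f` are raised by multiplication by `p ^ f` and `p ^ e` to the common
level `e + f`, without changing their rescaled images. -/
theorem add_mem_pBody_of_add_mem {K : PointedCone ℝ (Fin d → ℝ)} {p : ℕ} (hp : p ≠ 0)
    {T₁ T₂ T₃ : ℕ → Set (Fin d → ℤ)} (hT₁ : ∀ e, ∀ t ∈ T₁ e, p • t ∈ T₁ (e + 1))
    (hT₂ : ∀ e, ∀ t ∈ T₂ e, p • t ∈ T₂ (e + 1))
    (hadd : ∀ e, ∀ t₁ ∈ T₁ e, ∀ t₂ ∈ T₂ e, t₁ + t₂ ∈ T₃ e) {x y : Fin d → ℝ}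
    (hx : x ∈ pBody K p T₁) (hy : y ∈ pBody K p T₂) : x + y ∈ pBody K p T₃ := by
  obtain ⟨e, t, ht, hxt⟩ := mem_pBody.1 hx
  obtain ⟨f, s, hs, hys⟩ := mem_pBody.1 hy
  refine mem_pBody.2 ⟨e + f, p ^ f • t + p ^ e • s, hadd _ _ (pow_nsmul_mem hT₁ ht f) _ ?_, ?_⟩
  · rw [add_comm e f]; exact pow_nsmul_mem hT₂ hs e
  · rw [map_add, smul_add, inv_pow_smul_latticeCast_pow_nsmul hp, add_comm e f,
      inv_pow_smul_latticeCast_pow_nsmul hp, add_sub_add_comm]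
    exact K.add_mem_interior hxt (interior_subset hys)

/-- The Brunn-Minkowski inequality for the volumes of the complements. -/
theorem volume_pCobody_rpow_le [NeZero d] {K : PointedCone ℝ (Fin d → ℝ)} {p : ℕ} (hp : p ≠ 0)
    {T₁ T₂ T₃ : ℕ → Set (Fin d → ℤ)} (hT₁ : ∀ e, ∀ t ∈ T₁ e, p • t ∈ T₁ (e + 1))
    (hT₂ : ∀ e, ∀ t ∈ T₂ e, p • t ∈ T₂ (e + 1))
    (hadd : ∀ e, ∀ t₁ ∈ T₁ e, ∀ t₂ ∈ T₂ e, t₁ + t₂ ∈ T₃ e)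
    (hb₁ : Bornology.IsBounded (pCobody K p T₁)) (hb₂ : Bornology.IsBounded (pCobody K p T₂))
    (hb₃ : Bornology.IsBounded (pCobody K p T₃)) :
    volume (pCobody K p T₃) ^ (1 / (d : ℝ)) ≤
      volume (pCobody K p T₁) ^ (1 / (d : ℝ)) + volume (pCobody K p T₂) ^ (1 / (d : ℝ)) := by
  have h := measure_rpow_le_add_of_radial (E := Fin d → ℝ) volume
    (measurableSet_pCobody K p T₁) (measurableSet_pCobody K p T₂) (measurableSet_pCobody K p T₃)
    hb₁ hb₂ hb₃ (fun x hx s hs hs1 => smul_mem_pCobody hx hs hs1)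
    (fun x hx s hs hs1 => smul_mem_pCobody hx hs hs1)
    (fun x hx s hs hs1 => smul_mem_pCobody hx hs hs1) (by
      intro x s t hs ht hx
      by_contra! hcon
      have hxK : x ∈ interior (K : Set (Fin d → ℝ)) := by
        have := K.smul_mem_interior hx.1 (inv_pos.2 (add_pos hs ht))
        rwa [smul_smul, inv_mul_cancel₀ (add_pos hs ht).ne', one_smul] at this
      have h1 : s • x ∈ pBody K p T₁ := by
        by_contra h; exact hcon.1 ⟨K.smul_mem_interior hxK hs, h⟩
      have h2 : t • x ∈ pBody K p T₂ := by
        by_contra h; exact hcon.2 ⟨K.smul_mem_interior hxK ht, h⟩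
      refine hx.2 ?_
      rw [add_smul]
      exact add_mem_pBody_of_add_mem hp hT₁ hT₂ hadd h1 h2)
  simpa using h

/-- The rescaled point is the apex of a translate of the open cone. -/
theorem inv_pow_smul_mem_closure_pBody {K : PointedCone ℝ (Fin d → ℝ)} {p : ℕ}
    {T : ℕ → Set (Fin d → ℤ)} (hK : (interior (K : Set (Fin d → ℝ))).Nonempty) {e : ℕ}
    {t : Fin d → ℤ} (ht : t ∈ T e) :
    ((p : ℝ) ^ e)⁻¹ • latticeCast d t ∈ closure (pBody K p T) := by
  obtain ⟨x, hx⟩ := hK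
  have h1 : Tendsto (fun ε : ℝ => ((p : ℝ) ^ e)⁻¹ • latticeCast d t + ε • x) (𝓝[>] 0)
      (𝓝 (((p : ℝ) ^ e)⁻¹ • latticeCast d t)) := by
    have : Continuous fun ε : ℝ => ((p : ℝ) ^ e)⁻¹ • latticeCast d t + ε • x := by fun_prop
    simpa using (this.tendsto 0).mono_left nhdsWithin_le_nhds
  refine mem_closure_of_tendsto h1 ?_
  filter_upwards [self_mem_nhdsWithin] with ε hε
  refine mem_pBody.2 ⟨e, t, ht, ?_⟩
  rw [add_sub_cancel_left]
  exact K.smul_mem_interior hx hε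

theorem tendsto_natCast_pow_atTop {p : ℕ} (hp : 1 < p) :
    Tendsto (fun e : ℕ => (p : ℝ) ^ e) atTop atTop :=
  tendsto_pow_atTop_atTop_of_one_lt (by exact_mod_cast hp)

theorem tendsto_inv_smul_latticeCast_sub {c : ℕ → ℝ} (hc : Tendsto c atTop atTop)
    {u : ℕ → Fin d → ℤ} {x : Fin d → ℝ}
    (hu : Tendsto (fun n => (c n)⁻¹ • latticeCast d (u n)) atTop (𝓝 x)) (w : Fin d → ℤ) :
    Tendsto (fun n => (c n)⁻¹ • latticeCast d (u n - w)) atTop (𝓝 x) := by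
  have h1 : Tendsto (fun n => (c n)⁻¹ • latticeCast d w) atTop (𝓝 0) := by
    simpa using hc.inv_tendsto_atTop.smul_const (latticeCast d w)
  simpa [smul_sub] using hu.sub h1

theorem exists_norm_le_mul_dotProduct (K : PointedCone ℝ (Fin d → ℝ)) (a : Fin d → ℝ)
    (ha : ∀ x ∈ closure (K : Set (Fin d → ℝ)), x ≠ 0 → 0 < a ⬝ᵥ x) :
    ∃ κ : ℝ, 0 ≤ κ ∧ ∀ x ∈ K, ‖x‖ ≤ κ * (a ⬝ᵥ x) := by
  obtain ⟨κ, h0, h⟩ := PointedCone.exists_norm_le_mul K.closure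
    isClosed_closure (fun x => a ⬝ᵥ x) (by simp only [dotProduct]; fun_prop)
    (fun t x => by simp [dotProduct_smul]) ha
  exact ⟨κ, h0, fun x hx => h x (subset_closure hx)⟩

theorem continuous_dotProduct_left (a : Fin d → ℝ) : Continuous fun x : Fin d → ℝ => a ⬝ᵥ x := by
  simp only [dotProduct]; fun_prop

theorem isBounded_pCobody {S : AddSubmonoid (Fin d → ℤ)}
    (hS : AddSubgroup.closure (S : Set (Fin d → ℤ)) = ⊤) {p : ℕ} (hp : 1 < p)
    {T : ℕ → Set (Fin d → ℤ)} (a : Fin d → ℝ)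
    (ha : ∀ x ∈ closure (PointedCone.hull ℝ (latticeCast d '' S) : Set (Fin d → ℝ)), x ≠ 0 →
      0 < a ⬝ᵥ x) {b : ℝ} (hb : ∀ e, ∀ u ∈ S, b * (p : ℝ) ^ e < a ⬝ᵥ latticeCast d u → u ∈ T e) :
    Bornology.IsBounded (pCobody (PointedCone.hull ℝ (latticeCast d '' S)) p T) := by
  set K := PointedCone.hull ℝ (latticeCast d '' S) with hK
  obtain ⟨κ, hκ, hnorm⟩ := exists_norm_le_mul_dotProduct K a ha
  have hc := tendsto_natCast_pow_atTop hp
  -- Lattice points close to `p ^ e • x` lie in `S` and have value above `b * p ^ e`, hence lie in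
  -- `T e`.
  have hcl : ∀ x ∈ interior (K : Set (Fin d → ℝ)), b < a ⬝ᵥ x → x ∈ closure (pBody K p T) := by
    intro x hx hbx
    have hlim := tendsto_floor_div (fun e => (p : ℝ) ^ e) hc x
    have hmem := eventually_mem_of_tendsto_interior S hS x hx _ hc _ hlim
    have hval := (((continuous_dotProduct_left a).tendsto x).comp hlim).eventually (lt_mem_nhds hbx)
    refine mem_closure_of_tendsto hlim ?_ |> closure_closure.subset
    filter_upwards [hmem, hval] with e h1 h2
    refine inv_pow_smul_mem_closure_pBody ⟨x, hx⟩ (hb e _ h1 ?_)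
    have hpos : (0 : ℝ) < (p : ℝ) ^ e := by positivity
    simp only [Function.comp, dotProduct_smul, smul_eq_mul] at h2
    rwa [← div_eq_inv_mul, lt_div_iff₀ hpos] at h2
  refine isBounded_iff_forall_norm_le.2 ⟨κ * b, fun x hx => ?_⟩
  refine (hnorm x (interior_subset hx.1)).trans (mul_le_mul_of_nonneg_left ?_ hκ)
  -- Write `x = (1 - ε) • x + ε • x`: the first summand still has value above `b`, so it lies in the
  -- closure of the body, and the second is interior to the cone, so the sum lies in the body
  -- itself.
  by_contra! hlt
  have h1 : Tendsto (fun ε : ℝ => a ⬝ᵥ ((1 - ε) • x)) (𝓝[>] 0) (𝓝 (a ⬝ᵥ x)) := by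
    have : Continuous fun ε : ℝ => a ⬝ᵥ ((1 - ε) • x) :=
      (continuous_dotProduct_left a).comp (by fun_prop)
    simpa using (this.tendsto 0).mono_left nhdsWithin_le_nhds
  obtain ⟨ε, h2, h3, h4⟩ := ((h1.eventually (lt_mem_nhds hlt)).and
    (Ioo_mem_nhdsGT (show (0 : ℝ) < 1 by norm_num))).exists
  have h5 := hcl _ (K.smul_mem_interior hx.1 (sub_pos.2 h4)) h2
  have h6 := closure_add_subset_of_isOpen isOpen_interior
    (fun y hy z hz => add_mem_pBody hy (interior_subset hz)) _ h5 _
    (K.smul_mem_interior hx.1 h3)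
  rw [← add_smul, sub_add_cancel, one_smul] at h6
  exact hx.2 h6

/-- Rescaling makes the fixed shift `w` disappear. Off the frontier of `K` and the boundary of the
body inside `int K`, both null, the summand is eventually constant along lattice points approaching
`x`: zero in the body and outside `K`, and `N` in the complement of the body in `int K`. -/
theorem tendsto_tsum_div_volume_pCobody {S : AddSubmonoid (Fin d → ℤ)}
    (hS : AddSubgroup.closure (S : Set (Fin d → ℤ)) = ⊤) {p : ℕ} (hp : 1 < p)
    {T : ℕ → Set (Fin d → ℤ)} (hTS : ∀ e, ∀ t ∈ T e, ∀ s ∈ S, t + s ∈ T e)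
    (hT : ∀ e, ∀ t ∈ T e, p • t ∈ T (e + 1)) (a : Fin d → ℝ)
    (ha : ∀ x ∈ closure (PointedCone.hull ℝ (latticeCast d '' S) : Set (Fin d → ℝ)), x ≠ 0 →
      0 < a ⬝ᵥ x) {G : ℕ → (Fin d → ℤ) → ℝ≥0∞} {N : ℝ≥0∞} (hN : N ≠ ∞)
    (hGN : ∀ e u, G e u ≤ N) (hGS : ∀ e u, G e u ≠ 0 → u ∈ S) {b : ℝ}
    (hGb : ∀ e u, G e u ≠ 0 → a ⬝ᵥ latticeCast d u ≤ b * (p : ℝ) ^ e) (w : Fin d → ℤ)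
    (hG0 : ∀ e u, u - w ∈ T e → G e u = 0) (hG1 : ∀ e u, u - w ∈ S → u ∉ T e → G e u = N) :
    Tendsto (fun e => (∑' u, G e u) / ((p : ℝ≥0∞) ^ e) ^ d) atTop
      (𝓝 (N * volume (pCobody (PointedCone.hull ℝ (latticeCast d '' S)) p T))) := by
  set K := PointedCone.hull ℝ (latticeCast d '' S) with hK
  obtain ⟨κ, hκ, hnorm⟩ := exists_norm_le_mul_dotProduct K a ha
  have hc := tendsto_natCast_pow_atTop hp
  have hp0 : (0 : ℝ) < p := by exact_mod_cast hp.le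
  have hSK : ∀ u ∈ S, latticeCast d u ∈ K := fun u hu => Submodule.subset_span ⟨u, hu, rfl⟩
  have hofReal : ∀ e : ℕ, (p : ℝ≥0∞) ^ e = ENNReal.ofReal ((p : ℝ) ^ e) := fun e => by
    rw [ENNReal.ofReal_pow hp0.le, ENNReal.ofReal_natCast]
  simp only [hofReal]
  have hnull1 : ∀ᵐ x : Fin d → ℝ, x ∉ frontier (K : Set (Fin d → ℝ)) :=
    measure_eq_zero_iff_ae_notMem.1 (Convex.addHaar_frontier volume K.convex)
  have hnull2 : ∀ᵐ x : Fin d → ℝ,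
      x ∉ (closure (pBody K p T) \ pBody K p T) ∩ interior (K : Set (Fin d → ℝ)) :=
    measure_eq_zero_iff_ae_notMem.1 (measure_closure_diff_inter_eq_zero volume
      (isOpen_pBody K p T) isOpen_interior (fun x hx t ht => K.smul_mem_interior hx ht)
      (fun y hy z hz => add_mem_pBody hy (interior_subset hz)))
  refine tendsto_tsum_div_pow (fun e => (p : ℝ) ^ e)
    (fun e => one_le_pow₀ (by exact_mod_cast hp.le)) hc G N hN hGN _
    (measurableSet_pCobody K p T) (κ * b) ?_ ?_
  · intro e u hu
    have hpe : (0 : ℝ) < (p : ℝ) ^ e := by positivity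
    have h1 := hnorm _ (K.smul_mem (inv_nonneg.2 hpe.le) (hSK u (hGS e u hu)))
    refine h1.trans (mul_le_mul_of_nonneg_left ?_ hκ)
    rw [dotProduct_smul, smul_eq_mul, ← div_eq_inv_mul, div_le_iff₀ hpe]
    exact hGb e u hu
  · filter_upwards [hnull1, hnull2] with x hx1 hx2 u hu
    by_cases hxK : x ∈ interior (K : Set (Fin d → ℝ))
    · by_cases hxT : x ∈ pBody K p T
      · rw [Set.indicator_of_notMem (fun h => h.2 hxT)]
        obtain ⟨e, t, ht, hxt⟩ := mem_pBody.1 hxT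
        -- The multiples `p ^ (n - e) • t` lie in `T n` and all rescale to the same point, so what
        -- remains of `u n - w` approaches an interior point of `K` and eventually lies in `S`.
        have h1 : Tendsto (fun n => ((p : ℝ) ^ n)⁻¹ • latticeCast d (u n - w - p ^ (n - e) • t))
            atTop (𝓝 (x - ((p : ℝ) ^ e)⁻¹ • latticeCast d t)) := by
          refine ((tendsto_inv_smul_latticeCast_sub hc hu w).sub_const _).congr' ?_
          filter_upwards [eventually_ge_atTop e] with n hn
          obtain ⟨k, rfl⟩ := Nat.exists_eq_add_of_le hn
          rw [map_sub _ (u _ - w), smul_sub, Nat.add_sub_cancel_left,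
            inv_pow_smul_latticeCast_pow_nsmul (by omega)]
        filter_upwards [eventually_mem_of_tendsto_interior S hS _ hxt _ hc _ h1,
          eventually_ge_atTop e] with n hn hen
        obtain ⟨k, rfl⟩ := Nat.exists_eq_add_of_le hen
        refine hG0 _ _ ?_
        have := hTS _ _ (pow_nsmul_mem hT ht k) _ hn
        rwa [Nat.add_sub_cancel_left, add_sub_cancel] at this
      · rw [Set.indicator_of_mem (show x ∈ pCobody K p T from ⟨hxK, hxT⟩)]
        have hxcl : x ∈ (closure (pBody K p T))ᶜ := fun h => hx2 ⟨⟨h, hxT⟩, hxK⟩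
        filter_upwards [eventually_mem_of_tendsto_interior S hS _ hxK _ hc _
          (tendsto_inv_smul_latticeCast_sub hc hu w),
          hu.eventually (isClosed_closure.isOpen_compl.mem_nhds hxcl)] with n h1 h2
        exact hG1 _ _ h1 fun h => h2 (inv_pow_smul_mem_closure_pBody ⟨x, hxK⟩ h)
    · rw [Set.indicator_of_notMem (fun h => hxK h.1)]
      have hxcl : x ∈ (closure (K : Set (Fin d → ℝ)))ᶜ := fun h => hx1 ⟨h, hxK⟩
      filter_upwards [hu.eventually (isClosed_closure.isOpen_compl.mem_nhds hxcl)] with n hn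
      by_contra hne
      have hpe : (0 : ℝ) < (p : ℝ) ^ n := by positivity
      exact hn (subset_closure (K.smul_mem (inv_nonneg.2 hpe.le) (hSK _ (hGS _ _ hne))))

end PBodies

/-! ### The value filtration and its graded pieces. -/

/-- Additivity of length in the exact sequence `0 → A / (A ∩ B) → M / B → M / (A + B) → 0`. -/
theorem Submodule.length_quotient_eq_add {R M : Type*} [Ring R] [AddCommGroup M] [Module R M]
    (A B C : Submodule R M) (hC : B ⊔ A = C) : Module.length R (M ⧸ B) =
      Module.length R (A ⧸ B.comap A.subtype) + Module.length R (M ⧸ C) := by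
  have hBC : B ≤ C := hC ▸ le_sup_left
  refine Module.length_eq_add_of_exact (Submodule.mapQ (B.comap A.subtype) B A.subtype le_rfl)
    (Submodule.factor hBC) ?_ (Submodule.factor_surjective hBC) ?_
  · rw [← LinearMap.ker_eq_bot, Submodule.ker_mapQ]
    exact Submodule.mkQ_map_self _
  · rw [LinearMap.exact_iff]
    ext z
    obtain ⟨x, rfl⟩ := Submodule.mkQ_surjective B z
    have hker : B.mkQ x ∈ LinearMap.ker (Submodule.factor hBC) ↔ x ∈ B ⊔ A := by
      rw [hC]; exact Submodule.Quotient.mk_eq_zero C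
    rw [hker, LinearMap.mem_range, Submodule.mkQ_apply]
    constructor
    · intro hx
      obtain ⟨i, hi, a, ha, rfl⟩ := Submodule.mem_sup.1 hx
      refine ⟨Submodule.Quotient.mk ⟨a, ha⟩, ?_⟩
      rw [Submodule.mapQ_apply, Submodule.Quotient.eq]
      simpa using hi
    · rintro ⟨y, hy⟩
      obtain ⟨a, rfl⟩ := Submodule.mkQ_surjective _ y
      rw [Submodule.mkQ_apply, Submodule.mapQ_apply, Submodule.Quotient.eq] at hy
      have h1 := sub_mem (Submodule.mem_sup_right a.2 : (a : M) ∈ B ⊔ A) (Submodule.mem_sup_left hy)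
      simpa using h1

namespace LatticeValuation

section Levels

variable {F : Type*} [Field F] {d : ℕ} (ν : LatticeValuation F d)

/-- The real-valued valuation `x ↦ ⟨weight, ν x⟩`. -/
noncomputable def ord (x : Fˣ) : ℝ := ν.emb (ν.val (Additive.ofMul x))

theorem ord_mul (x y : Fˣ) : ν.ord (x * y) = ν.ord x + ν.ord y := by
  rw [ord, ofMul_mul, map_add, emb_add]; rfl

theorem ord_inv (x : Fˣ) : ν.ord x⁻¹ = -ν.ord x := by
  rw [ord, ofMul_inv, map_neg, emb_neg]; rfl

theorem min_le_ord {x y z : Fˣ} (h : (z : F) = x + y) : min (ν.ord x) (ν.ord y) ≤ ν.ord z :=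
  ν.min_le_val_add x y z h

theorem emb_eq_dotProduct (u : Fin d → ℤ) : ν.emb u = ν.weight ⬝ᵥ latticeCast d u := rfl

theorem emb_nsmul (n : ℕ) (u : Fin d → ℤ) : ν.emb (n • u) = n * ν.emb u := by
  rw [emb_eq_dotProduct, map_nsmul, ← Nat.cast_smul_eq_nsmul ℝ, dotProduct_smul, smul_eq_mul]
  rfl

/-- This is where rational independence of the weights enters: each step of the filtration has a
single lattice degree. -/
theorem emb_injective : Function.Injective ν.emb := by
  intro u v huv
  have h1 : ν.emb (u + -v) = 0 := by rw [emb_add, emb_neg, huv, add_neg_cancel]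
  have h2 := Fintype.linearIndependent_iff.1 ν.linearIndependent_weight
    (fun i => (((u + -v) i : ℤ) : ℚ)) (by
      rw [← h1, emb, dotProduct]
      refine Finset.sum_congr rfl fun i _ => ?_
      rw [Rat.smul_def]
      push_cast
      ring)
  ext i
  have h3 := h2 i
  have h4 : (u + -v) i = 0 := by exact_mod_cast h3
  simp only [Pi.add_apply, Pi.neg_apply] at h4
  omega

theorem exists_unit_val_eq (u : Fin d → ℤ) : ∃ x : Fˣ, ν.val (Additive.ofMul x) = u := by
  obtain ⟨x, hx⟩ := ν.surjective_val u
  exact ⟨x.toMul, hx⟩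

variable {R : Type*} [CommRing R] [Algebra R F]

variable (R) in
/-- `R` is contained in the valuation ring. -/
def NonnegOn : Prop := ∀ (x : R) (y : Fˣ), (y : F) = algebraMap R F x → 0 ≤ ν.ord y

variable {ν}

/-- The `R`-submodule of `F` of the elements whose value lies in the upper set `P`. -/
noncomputable def levelSubmodule (h : ν.NonnegOn R) (P : UpperSet ℝ) : Submodule R F where
  carrier := {x | ∀ y : Fˣ, (y : F) = x → ν.ord y ∈ P}
  zero_mem' := fun y hy => absurd hy y.ne_zero
  add_mem' := by
    intro a b ha hb y hy
    by_cases ha0 : a = 0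
    · exact hb y (by rw [hy, ha0, zero_add])
    by_cases hb0 : b = 0
    · exact ha y (by rw [hy, hb0, add_zero])
    have h1 := ν.min_le_ord (x := Units.mk0 a ha0) (y := Units.mk0 b hb0) (z := y) (by simp [hy])
    rcases min_choice (ν.ord (Units.mk0 a ha0)) (ν.ord (Units.mk0 b hb0)) with h2 | h2
    · exact P.upper (h2 ▸ h1) (ha _ rfl)
    · exact P.upper (h2 ▸ h1) (hb _ rfl)
  smul_mem' := by
    intro r a ha y hy
    rw [Algebra.smul_def] at hy
    have hne : algebraMap R F r * a ≠ 0 := hy ▸ y.ne_zero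
    have hr0 := left_ne_zero_of_mul hne
    have ha0 := right_ne_zero_of_mul hne
    have h1 : y = Units.mk0 _ hr0 * Units.mk0 _ ha0 := by ext; simp [hy]
    rw [h1, ord_mul]
    exact P.upper (le_add_of_nonneg_left (h r _ rfl)) (ha _ rfl)

theorem levelSubmodule_mono {h : ν.NonnegOn R} {P Q : UpperSet ℝ} (hPQ : ∀ s ∈ P, s ∈ Q) :
    levelSubmodule h P ≤ levelSubmodule h Q := fun _ hx y hy => hPQ _ (hx y hy)

/-- The elements of value at least `s`. -/
noncomputable abbrev levelGE (h : ν.NonnegOn R) (s : ℝ) : Submodule R F :=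
  levelSubmodule h (UpperSet.Ici s)

/-- The elements of value greater than `s`. -/
noncomputable abbrev levelGT (h : ν.NonnegOn R) (s : ℝ) : Submodule R F :=
  levelSubmodule h (UpperSet.Ioi s)

theorem mem_levelGE {h : ν.NonnegOn R} {s : ℝ} {x : F} :
    x ∈ levelGE h s ↔ ∀ y : Fˣ, (y : F) = x → s ≤ ν.ord y := Iff.rfl

theorem mem_levelGT {h : ν.NonnegOn R} {s : ℝ} {x : F} :
    x ∈ levelGT h s ↔ ∀ y : Fˣ, (y : F) = x → s < ν.ord y := Iff.rfl

theorem levelGT_le_levelGE (h : ν.NonnegOn R) (s : ℝ) : levelGT h s ≤ levelGE h s :=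
  fun _ hx y hy => (mem_levelGT.1 hx y hy).le

theorem mul_mem_levelGE {h : ν.NonnegOn R} {s : ℝ} {x : F} (g : Fˣ) (hx : x ∈ levelGE h s) :
    (g : F) * x ∈ levelGE h (ν.ord g + s) := by
  refine mem_levelGE.2 fun y hy => ?_
  have h1 := mem_levelGE.1 hx (g⁻¹ * y) (by simp [hy])
  rw [ord_mul, ord_inv] at h1
  linarith

theorem mul_mem_levelGT {h : ν.NonnegOn R} {s : ℝ} {x : F} (g : Fˣ) (hx : x ∈ levelGT h s) :
    (g : F) * x ∈ levelGT h (ν.ord g + s) := by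
  refine mem_levelGT.2 fun y hy => ?_
  have h1 := mem_levelGT.1 hx (g⁻¹ * y) (by simp [hy])
  rw [ord_mul, ord_inv] at h1
  linarith

/-- The ideal of the elements of `R` of value at least `s`. -/
noncomputable def idealGE (h : ν.NonnegOn R) (s : ℝ) : Ideal R :=
  (levelGE h s).comap (Algebra.linearMap R F)

/-- The ideal of the elements of `R` of value greater than `s`. -/
noncomputable def idealGT (h : ν.NonnegOn R) (s : ℝ) : Ideal R :=
  (levelGT h s).comap (Algebra.linearMap R F)

theorem mem_idealGE {h : ν.NonnegOn R} {s : ℝ} {x : R} :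
    x ∈ idealGE h s ↔ algebraMap R F x ∈ levelGE h s := Iff.rfl

theorem mem_idealGT {h : ν.NonnegOn R} {s : ℝ} {x : R} :
    x ∈ idealGT h s ↔ algebraMap R F x ∈ levelGT h s := Iff.rfl

theorem idealGT_le_idealGE (h : ν.NonnegOn R) (s : ℝ) : idealGT h s ≤ idealGE h s :=
  fun _ hx => levelGT_le_levelGE h s hx

variable (ν) in
/-- The set of the values of the nonzero elements of an ideal. -/
def valSet (I : Ideal R) : Set (Fin d → ℤ) :=
  {u | ∃ x : Fˣ, (∃ r ∈ I, algebraMap R F r = x) ∧ ν.val (Additive.ofMul x) = u}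

theorem add_mem_valSet_mul {I J : Ideal R} {u v : Fin d → ℤ} (hu : u ∈ ν.valSet I)
    (hv : v ∈ ν.valSet J) : u + v ∈ ν.valSet (I * J) := by
  obtain ⟨x, ⟨r, hr, hrx⟩, rfl⟩ := hu
  obtain ⟨y, ⟨s, hs, hsy⟩, rfl⟩ := hv
  exact ⟨x * y, ⟨r * s, Ideal.mul_mem_mul hr hs, by simp [hrx, hsy]⟩, by rw [ofMul_mul, map_add]⟩

theorem nsmul_mem_valSet {I J : Ideal R} {p : ℕ} (hIJ : ∀ x ∈ I, x ^ p ∈ J) {u : Fin d → ℤ}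
    (hu : u ∈ ν.valSet I) : p • u ∈ ν.valSet J := by
  obtain ⟨x, ⟨r, hr, hrx⟩, rfl⟩ := hu
  exact ⟨x ^ p, ⟨r ^ p, hIJ r hr, by simp [hrx]⟩, by rw [ofMul_pow, map_nsmul]⟩

variable (ν R) in
/-- The semigroup of the values of the nonzero elements of `R`. -/
def valueMonoid : AddSubmonoid (Fin d → ℤ) where
  carrier := ν.valSet (⊤ : Ideal R)
  zero_mem' := ⟨1, ⟨1, Submodule.mem_top, by simp⟩, by simp⟩
  add_mem' := fun hu hv => by simpa using add_mem_valSet_mul hu hv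

variable (ν R) in
theorem valueSet_eq_image : ν.valueSet R = latticeCast d '' (ν.valueMonoid R) := by
  ext u
  constructor
  · rintro ⟨x, ⟨r, hr⟩, rfl⟩
    exact ⟨_, ⟨x, ⟨r, Submodule.mem_top, hr⟩, rfl⟩, rfl⟩
  · rintro ⟨_, ⟨x, ⟨r, -, hr⟩, rfl⟩, rfl⟩
    exact ⟨x, ⟨r, hr⟩, rfl⟩

variable (ν R) in
-- Every element of `F` is a fraction and `ν` is onto `ℤ^d`.
theorem closure_valueMonoid [IsDomain R] [IsFractionRing R F] :
    AddSubgroup.closure (ν.valueMonoid R : Set (Fin d → ℤ)) = ⊤ := by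
  rw [eq_top_iff]
  intro u _
  obtain ⟨x, rfl⟩ := ν.exists_unit_val_eq u
  obtain ⟨a, b, hb, hab⟩ := IsFractionRing.div_surjective (A := R) (x : F)
  have hb0 : algebraMap R F b ≠ 0 := by
    simpa using nonZeroDivisors.ne_zero hb
  have ha0 : algebraMap R F a ≠ 0 := fun h => x.ne_zero (by rw [← hab, h, zero_div])
  have h1 : x = Units.mk0 _ ha0 * (Units.mk0 _ hb0)⁻¹ := by
    ext; simp [← hab, div_eq_mul_inv]
  rw [h1, ofMul_mul, map_add, ofMul_inv, map_neg]
  exact add_mem (AddSubgroup.subset_closure ⟨_, ⟨a, Submodule.mem_top, rfl⟩, rfl⟩)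
    (neg_mem (AddSubgroup.subset_closure ⟨_, ⟨b, Submodule.mem_top, rfl⟩, rfl⟩))

theorem mem_valSet_of_mem_valueMonoid {h : ν.NonnegOn R} {I : Ideal R} {s : ℝ}
    (hI : idealGE h s ≤ I) {u : Fin d → ℤ} (hu : u ∈ ν.valueMonoid R) (hs : s ≤ ν.emb u) :
    u ∈ ν.valSet I := by
  obtain ⟨x, ⟨r, -, hr⟩, rfl⟩ := hu
  refine ⟨x, ⟨r, hI (mem_idealGE.2 (mem_levelGE.2 fun y hy => ?_)), hr⟩, rfl⟩
  rwa [Units.ext (hy.trans hr)]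

end Levels

section Gap

variable {F : Type*} [Field F] {d : ℕ} {ν : LatticeValuation F d}
  {R : Type*} [CommRing R] [Algebra R F]

/-- The length of the piece of `R / I` in degree `u`. -/
noncomputable def gap (h : ν.NonnegOn R) (I : Ideal R) (u : Fin d → ℤ) : ℕ∞ :=
  Module.length R (idealGE h (ν.emb u) ⧸
    Submodule.comap (Submodule.subtype (idealGE h (ν.emb u))) (I ⊔ idealGT h (ν.emb u)))

theorem gap_eq_zero {h : ν.NonnegOn R} {I : Ideal R} {u : Fin d → ℤ}
    (hle : idealGE h (ν.emb u) ≤ I ⊔ idealGT h (ν.emb u)) : gap h I u = 0 := by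
  rw [gap, Module.length_eq_zero_iff, Submodule.Quotient.subsingleton_iff,
    Submodule.comap_subtype_eq_top]
  exact hle

theorem mem_valSet_of_notMem_idealGT {h : ν.NonnegOn R} {I : Ideal R} {u : Fin d → ℤ} {x : R}
    (hx : x ∈ idealGE h (ν.emb u)) (hxI : x ∈ I) (hx' : x ∉ idealGT h (ν.emb u)) :
    u ∈ ν.valSet I := by
  rw [mem_idealGT, mem_levelGT] at hx'
  push Not at hx'
  obtain ⟨y, hy, hle⟩ := hx'
  exact ⟨y, ⟨x, hxI, hy.symm⟩,
    ν.emb_injective (le_antisymm hle (mem_levelGE.1 (mem_idealGE.1 hx) y hy))⟩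

theorem gap_eq_zero_of_notMem {h : ν.NonnegOn R} (I : Ideal R) {u : Fin d → ℤ}
    (hu : u ∉ ν.valueMonoid R) : gap h I u = 0 := by
  refine gap_eq_zero fun x hx => Ideal.mem_sup_right ?_
  by_contra hx'
  exact hu (mem_valSet_of_notMem_idealGT hx Submodule.mem_top hx')

theorem gap_eq_zero_of_le {h : ν.NonnegOn R} {I : Ideal R} {s : ℝ} (hI : idealGE h s ≤ I)
    {u : Fin d → ℤ} (hu : s ≤ ν.emb u) : gap h I u = 0 :=
  gap_eq_zero fun _ hx => Ideal.mem_sup_left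
    (hI (levelSubmodule_mono (h := h) (fun _ ht => le_trans hu ht) hx))

theorem length_quotient_sup_idealGT (h : ν.NonnegOn R) (I : Ideal R) (u : Fin d → ℤ) :
    Module.length R (R ⧸ I ⊔ idealGT h (ν.emb u)) =
      gap h I u + Module.length R (R ⧸ I ⊔ idealGE h (ν.emb u)) := by
  refine Submodule.length_quotient_eq_add _ _ _ ?_
  rw [sup_assoc, sup_eq_right.2 (idealGT_le_idealGE h _)]

/-- The filtration is climbed one value at a time, each value contributing its `gap`. -/
theorem length_quotient_sup_idealGE (h : ν.NonnegOn R) (I : Ideal R) (U : Finset (Fin d → ℤ)) :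
    ∀ s : ℝ, (∀ u, u ∈ U ↔ u ∈ ν.valueMonoid R ∧ ν.emb u < s) →
      Module.length R (R ⧸ I ⊔ idealGE h s) = ∑ u ∈ U, gap h I u := by
  classical
  induction U using Finset.induction_on_max_value ν.emb with
  | empty =>
    intro s hU
    have htop : I ⊔ idealGE h s = ⊤ := by
      rw [eq_top_iff]
      refine fun x _ => Ideal.mem_sup_right (mem_idealGE.2 (mem_levelGE.2 fun y hy => ?_))
      by_contra! hlt
      simpa using (hU _).2 ⟨⟨y, ⟨x, Submodule.mem_top, hy.symm⟩, rfl⟩, hlt⟩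
    rw [Finset.sum_empty, Module.length_eq_zero_iff, htop]
    exact Ideal.Quotient.subsingleton_iff.2 rfl
  | insert a U ha hmax ih =>
    intro s hU
    have has := (hU a).1 (Finset.mem_insert_self a U)
    -- No value of `R` lies strictly between the largest one, `a`, and the threshold `s`.
    have hGE : idealGE h s = idealGT h (ν.emb a) := by
      apply le_antisymm
      · exact fun x hx => levelSubmodule_mono (h := h) (fun t ht => lt_of_lt_of_le has.2 ht) hx
      · intro x hx
        refine mem_idealGE.2 (mem_levelGE.2 fun y hy => ?_)
        have h1 := mem_levelGT.1 (mem_idealGT.1 hx) y hy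
        by_contra! hlt
        have h2 := (hU _).2 ⟨⟨y, ⟨x, Submodule.mem_top, hy.symm⟩, rfl⟩, hlt⟩
        rcases Finset.mem_insert.1 h2 with h3 | h3
        · exact h1.ne' (congrArg ν.emb h3)
        · exact absurd (hmax _ h3) (not_le.2 h1)
    rw [hGE, length_quotient_sup_idealGT, Finset.sum_insert ha, ih]
    intro u
    constructor
    · intro hu
      refine ⟨((hU u).1 (Finset.mem_insert_of_mem hu)).1, lt_of_le_of_ne (hmax u hu) fun he => ?_⟩
      exact ha (ν.emb_injective he ▸ hu)
    · rintro ⟨hu, hlt⟩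
      have := (hU u).2 ⟨hu, hlt.trans has.2⟩
      exact (Finset.mem_insert.1 this).resolve_left fun he => hlt.ne (he ▸ rfl)

theorem length_quotient_eq_tsum_gap (h : ν.NonnegOn R) {I : Ideal R} {s : ℝ}
    (hI : idealGE h s ≤ I) (hfin : {u | u ∈ ν.valueMonoid R ∧ ν.emb u < s}.Finite) :
    ((Module.length R (R ⧸ I) : ℕ∞) : ℝ≥0∞) = ∑' u, ((gap h I u : ℕ∞) : ℝ≥0∞) := by
  have h1 := length_quotient_sup_idealGE h I hfin.toFinset s (by simp)
  rw [sup_eq_left.2 hI] at h1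
  rw [h1, tsum_eq_sum (s := hfin.toFinset)]
  · exact map_sum ENat.toENNRealRingHom _ _
  · intro u hu
    have : gap h I u = 0 := by
      by_cases hS : u ∈ ν.valueMonoid R
      · exact gap_eq_zero_of_le hI (not_lt.1 fun hlt => hu (by simpa using ⟨hS, hlt⟩))
      · exact gap_eq_zero_of_notMem I hS
    simp [this]

end Gap

end LatticeValuation

/-! ### Graded pieces compared with the residue field. -/

namespace LatticeValuation

section Residue

variable {F : Type*} [Field F] {d : ℕ} {ν : LatticeValuation F d}
  {R : Type*} [CommRing R] [Algebra R F]

/-- The residue field of `ν`, as an `R`-module. -/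
abbrev ResidueModule (h : ν.NonnegOn R) : Type _ :=
  levelGE h 0 ⧸ Submodule.comap (levelGE h 0).subtype (levelGT h 0)

/-- The residue field of `ν` is finitely generated as a module over `R`. -/
def ResidueFinite (h : ν.NonnegOn R) : Prop :=
  ∃ (n : ℕ) (y : Fin n → F), (∀ i, y i ∈ levelGE h 0) ∧
    ∀ x ∈ levelGE h 0, ∃ r : Fin n → R, x - ∑ i, r i • y i ∈ levelGT h 0

/-- The maximal ideal kills the residue module, which is therefore a quotient of a finite power of
`R / m`. -/
theorem length_residueModule_ne_top [IsLocalRing R] {h : ν.NonnegOn R} (hfin : ResidueFinite h)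
    (hm : ∀ x ∈ IsLocalRing.maximalIdeal R, algebraMap R F x ∈ levelGT h 0) :
    Module.length R (ResidueModule h) ≠ ⊤ := by
  obtain ⟨n, y, hy, hspan⟩ := hfin
  set m := IsLocalRing.maximalIdeal R
  have hmul : ∀ x ∈ m, ∀ z ∈ levelGE h 0, x • z ∈ levelGT h 0 := by
    intro x hx z hz
    by_cases hx0 : algebraMap R F x = 0
    · rw [Algebra.smul_def, hx0, zero_mul]; exact zero_mem _
    have h1 := mul_mem_levelGE (Units.mk0 _ hx0) hz
    rw [add_zero] at h1
    have h2 := mem_levelGT.1 (hm x hx) (Units.mk0 _ hx0) rfl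
    rw [Algebra.smul_def]
    exact levelSubmodule_mono (fun t ht => lt_of_lt_of_le h2 ht) h1
  let f : (Fin n → R ⧸ m) →ₗ[R] ResidueModule h :=
    Submodule.piQuotientLift (Ms := fun _ => R) (fun _ => m) _
      (fun i => LinearMap.toSpanSingleton R (levelGE h 0) ⟨y i, hy i⟩)
      (fun i x hx => hmul x hx _ (hy i))
  have hf : Function.Surjective f := by
    intro z
    obtain ⟨⟨x, hx⟩, rfl⟩ := Submodule.mkQ_surjective _ z
    obtain ⟨r, hr⟩ := hspan x hx
    refine ⟨fun i => Submodule.Quotient.mk (r i), ?_⟩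
    refine (Submodule.piQuotientLift_mk _ _ _ _ r).trans ?_
    rw [Submodule.mkQ_apply, Submodule.Quotient.eq]
    have hneg := neg_mem hr
    rw [neg_sub] at hneg
    simpa [LinearMap.lsum_apply] using hneg
  have h1 : Module.length R (Fin n → R ⧸ m) ≠ ⊤ := by
    have : IsSimpleModule R (R ⧸ m) := isSimpleModule_iff_quot_maximal.2
      ⟨m, inferInstance, ⟨LinearEquiv.refl R _⟩⟩
    rw [Module.length_pi_of_fintype]
    simp [Module.length_eq_one]
  exact ne_top_of_le_ne_top h1 (Module.length_le_of_surjective f hf)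

/-- Dividing by an element `g` of `F` of value `u` embeds the piece of `R` in degree `u` into the
residue field; `g` need not lie in `R`. -/
theorem exists_linearMap_residueModule (h : ν.NonnegOn R) (u : Fin d → ℤ) :
    ∃ φ : idealGE h (ν.emb u) →ₗ[R] ResidueModule h,
      LinearMap.ker φ =
        Submodule.comap (Submodule.subtype (idealGE h (ν.emb u))) (idealGT h (ν.emb u)) ∧
      ((∀ ξ ∈ levelGE h (ν.emb u), ∃ z : R, ξ - algebraMap R F z ∈ levelGT h (ν.emb u)) →
        Function.Surjective φ) := by
  obtain ⟨g, hg⟩ := ν.exists_unit_val_eq u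
  have hgu : ν.ord g = ν.emb u := congrArg ν.emb hg
  have hginv : ν.ord g⁻¹ = -ν.emb u := by rw [ord_inv, hgu]
  have hGE : ∀ x ∈ levelGE h (ν.emb u), ((g⁻¹ : Fˣ) : F) * x ∈ levelGE h 0 := fun x hx => by
    simpa [hginv] using mul_mem_levelGE g⁻¹ hx
  have hGT : ∀ x : F, ((g⁻¹ : Fˣ) : F) * x ∈ levelGT h 0 ↔ x ∈ levelGT h (ν.emb u) := fun x =>
    ⟨fun hx => by simpa [hgu] using mul_mem_levelGT g hx,
      fun hx => by simpa [hginv] using mul_mem_levelGT g⁻¹ hx⟩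
  let ψ : idealGE h (ν.emb u) →ₗ[R] levelGE h 0 :=
    LinearMap.codRestrict (levelGE h 0) (LinearMap.mulLeft R ((g⁻¹ : Fˣ) : F) ∘ₗ
      Algebra.linearMap R F ∘ₗ Submodule.subtype (idealGE h (ν.emb u))) (fun x => hGE _ x.2)
  have hψ : ∀ x, (ψ x : F) = (g⁻¹ : Fˣ) * algebraMap R F (x : R) := fun x => rfl
  refine ⟨Submodule.mkQ _ ∘ₗ ψ, ?_, ?_⟩
  · ext x
    rw [LinearMap.mem_ker, LinearMap.comp_apply, Submodule.mkQ_apply,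
      Submodule.Quotient.mk_eq_zero, Submodule.mem_comap, Submodule.mem_comap,
      Submodule.subtype_apply, hψ, hGT]
    rfl
  · intro hsurj z
    obtain ⟨⟨x, hx⟩, rfl⟩ := Submodule.mkQ_surjective _ z
    have h1 : (g : F) * x ∈ levelGE h (ν.emb u) := by simpa [hgu] using mul_mem_levelGE g hx
    obtain ⟨r, hr⟩ := hsurj _ h1
    have hrGE : r ∈ idealGE h (ν.emb u) := by
      have := sub_mem h1 (levelGT_le_levelGE h _ hr)
      rwa [sub_sub_cancel] at this
    refine ⟨⟨r, hrGE⟩, ?_⟩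
    rw [LinearMap.comp_apply, Submodule.mkQ_apply, Submodule.mkQ_apply, Submodule.Quotient.eq,
      Submodule.mem_comap, map_sub, Submodule.subtype_apply, Submodule.subtype_apply, hψ]
    have h2 := neg_mem ((hGT _).2 hr)
    rw [mul_sub, Units.inv_mul_cancel_left, neg_sub] at h2
    exact h2

theorem gap_le_length_residueModule (h : ν.NonnegOn R) (I : Ideal R) (u : Fin d → ℤ) :
    gap h I u ≤ Module.length R (ResidueModule h) := by
  obtain ⟨φ, hφ, -⟩ := exists_linearMap_residueModule h u
  have hle : LinearMap.ker φ ≤ Submodule.comap (Submodule.subtype (idealGE h (ν.emb u)))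
      (I ⊔ idealGT h (ν.emb u)) := hφ ▸ Submodule.comap_mono le_sup_right
  calc gap h I u ≤ Module.length R (idealGE h (ν.emb u) ⧸ LinearMap.ker φ) :=
        Module.length_le_of_surjective (Submodule.factor hle) (Submodule.factor_surjective hle)
    _ = Module.length R (LinearMap.range φ) := φ.quotKerEquivRange.length_eq
    _ ≤ _ := Module.length_le_of_injective (LinearMap.range φ).subtype Subtype.val_injective

/-- An ideal without elements of value `u` contributes nothing in that degree, so the full graded
piece of `R` survives. -/
theorem gap_eq_length_residueModule {h : ν.NonnegOn R} {I : Ideal R} {u : Fin d → ℤ}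
    (hu : u ∉ ν.valSet I)
    (hsurj : ∀ ξ ∈ levelGE h (ν.emb u), ∃ z : R, ξ - algebraMap R F z ∈ levelGT h (ν.emb u)) :
    gap h I u = Module.length R (ResidueModule h) := by
  obtain ⟨φ, hφ, hφs⟩ := exists_linearMap_residueModule h u
  have heq : Submodule.comap (Submodule.subtype (idealGE h (ν.emb u)))
      (I ⊔ idealGT h (ν.emb u)) = LinearMap.ker φ := by
    rw [hφ]
    refine le_antisymm ?_ (Submodule.comap_mono le_sup_right)
    rintro ⟨x, hx⟩ hxI
    obtain ⟨i, hi, t, ht, rfl⟩ := Submodule.mem_sup.1 (show x ∈ I ⊔ idealGT h (ν.emb u) from hxI)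
    have hiGE : i ∈ idealGE h (ν.emb u) := by
      have := sub_mem hx (idealGT_le_idealGE h _ ht)
      rwa [add_sub_cancel_right] at this
    have hiGT : i ∈ idealGT h (ν.emb u) := by
      by_contra hcon
      exact hu (mem_valSet_of_notMem_idealGT hiGE hi hcon)
    exact add_mem hiGT ht
  rw [gap, heq]
  exact (φ.quotKerEquivOfSurjective (hφs hsurj)).length_eq

/-- After a fixed shift, every residue class in degree `u` is attained on an ideal that has an
element of the shifted value. -/
theorem exists_shift [IsDomain R] [IsFractionRing R F] {h : ν.NonnegOn R}
    (hfin : ResidueFinite h) : ∃ w : Fin d → ℤ, ∀ (I : Ideal R) (u : Fin d → ℤ),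
      u - w ∈ ν.valSet I → ∀ ξ ∈ levelGE h (ν.emb u),
        ∃ z ∈ I, ξ - algebraMap R F z ∈ levelGT h (ν.emb u) := by
  obtain ⟨n, y, hy, hspan⟩ := hfin
  -- The shift is the value of a common denominator `b` of the lifts `y i` of residue generators, so
  -- it depends on neither `I` nor `u`.
  obtain ⟨⟨b, hb⟩, hby⟩ := IsLocalization.exist_integer_multiples_of_finite (nonZeroDivisors R) y
  choose a ha using hby
  have hb0 : algebraMap R F b ≠ 0 := by simpa using nonZeroDivisors.ne_zero hb
  refine ⟨ν.val (Additive.ofMul (Units.mk0 _ hb0)), fun I u hu ξ hξ => ?_⟩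
  obtain ⟨x, ⟨s, hs, hsx⟩, hxu⟩ := hu
  set g : Fˣ := x * Units.mk0 _ hb0 with hg
  have hgu : ν.ord g = ν.emb u := by
    rw [hg, ord, ofMul_mul, map_add, hxu, sub_add_cancel]
  have h1 : ((g⁻¹ : Fˣ) : F) * ξ ∈ levelGE h 0 := by
    have := mul_mem_levelGE g⁻¹ hξ
    rwa [ord_inv, hgu, neg_add_cancel] at this
  obtain ⟨r, hr⟩ := hspan _ h1
  have h2 := mul_mem_levelGT g hr
  rw [hgu, add_zero, mul_sub, Units.mul_inv_cancel_left] at h2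
  -- Since `a i = b * y i`, this element of `I` equals `g * ∑ r i • y i` in `F`, with `g = x * b` of
  -- value `u`.
  refine ⟨s * ∑ i, r i * a i, I.mul_mem_right _ hs, ?_⟩
  have h3 : algebraMap R F (s * ∑ i, r i * a i) = (g : F) * ∑ i, r i • y i := by
    rw [map_mul, map_sum, hsx, hg, Units.val_mul, Units.val_mk0, mul_assoc]
    congr 1
    rw [Finset.mul_sum]
    refine Finset.sum_congr rfl fun i _ => ?_
    have h4 := ha i
    simp only [Algebra.smul_def] at h4 ⊢
    rw [map_mul, h4]
    ring
  rwa [h3]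

end Residue

/-! ### Consequences of the OK conditions. -/

section OK

variable {F : Type*} [Field F] {d : ℕ} {ν : LatticeValuation F d}
  {R : Type*} [CommRing R] [IsLocalRing R] [Algebra R F]

theorem mem_valuationSubring_iff {x : F} :
    x ∈ ν.valuationSubring ↔ ∀ y : Fˣ, (y : F) = x → 0 ≤ ν.ord y := by
  constructor
  · rintro hx y rfl
    have h1 := hx y.ne_zero
    rw [emb_zero, Units.mk0_val] at h1
    exact h1
  · intro hx h0
    rw [emb_zero]
    exact hx _ rfl

theorem ord_pos_of_not_isUnit {x : ν.valuationSubring} (hx : ¬IsUnit x) (y : Fˣ)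
    (hy : (y : F) = x) : 0 < ν.ord y := by
  have h1 := mem_valuationSubring_iff.1 x.2 y hy
  refine lt_of_le_of_ne h1 fun h0 => hx ?_
  have h2 : ((y⁻¹ : Fˣ) : F) ∈ ν.valuationSubring := mem_valuationSubring_iff.2 fun z hz => by
    rw [Units.ext hz, ord_inv, ← h0, neg_zero]
  refine IsUnit.of_mul_eq_one ⟨_, h2⟩ (Subtype.ext ?_)
  simp [← hy]

theorem IsOKRelativeTo.nonnegOn (hν : ν.IsOKRelativeTo R) : ν.NonnegOn R := by
  obtain ⟨h, -⟩ := hν.dominated_and_finite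
  exact fun x y hy => mem_valuationSubring_iff.1 (h x) y hy

theorem IsOKRelativeTo.mem_levelGT (hν : ν.IsOKRelativeTo R) {x : R}
    (hx : x ∈ IsLocalRing.maximalIdeal R) : algebraMap R F x ∈ levelGT hν.nonnegOn 0 := by
  obtain ⟨h, hloc, -⟩ := hν.dominated_and_finite
  intro y hy
  refine ord_pos_of_not_isUnit
    (x := (algebraMap R F).codRestrict ν.valuationSubring.toSubring h x) (fun hu => ?_) y hy
  exact (IsLocalRing.mem_maximalIdeal _).1 hx (hloc.map_nonunit x hu)

theorem IsOKRelativeTo.residueFinite (hν : ν.IsOKRelativeTo R) :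
    ResidueFinite hν.nonnegOn := by
  obtain ⟨h, hloc, hfin⟩ := hν.dominated_and_finite
  set f : R →+* ν.valuationSubring := (algebraMap R F).codRestrict ν.valuationSubring.toSubring h
    with hf
  let _ : Algebra (IsLocalRing.ResidueField R) (IsLocalRing.ResidueField ν.valuationSubring) :=
    (IsLocalRing.ResidueField.map f).toAlgebra
  have hfin' : Module.Finite (IsLocalRing.ResidueField R)
    (IsLocalRing.ResidueField ν.valuationSubring) := hfin
  obtain ⟨n, s, hs⟩ := Module.Finite.exists_fin (R := IsLocalRing.ResidueField R)
    (M := IsLocalRing.ResidueField ν.valuationSubring)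
  choose y hy using fun i => IsLocalRing.residue_surjective (s i)
  refine ⟨n, fun i => y i, fun i => mem_valuationSubring_iff.1 (y i).2, fun x hx => ?_⟩
  set x' : ν.valuationSubring := ⟨x, mem_valuationSubring_iff.2 hx⟩ with hx'
  obtain ⟨c, hc⟩ := (Submodule.mem_span_range_iff_exists_fun _).1
    (hs ▸ Submodule.mem_top : IsLocalRing.residue _ x' ∈ _)
  choose r hr using fun i => IsLocalRing.residue_surjective (c i)
  have h1 : IsLocalRing.residue _ (x' - ∑ i, f (r i) * y i) = 0 := by
    rw [map_sub, map_sum, ← hc, sub_eq_zero]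
    refine Finset.sum_congr rfl fun i _ => ?_
    rw [map_mul, hy, ← hr, Algebra.smul_def]
    rfl
  rw [IsLocalRing.residue_eq_zero_iff, IsLocalRing.mem_maximalIdeal] at h1
  refine ⟨r, fun z hz => ord_pos_of_not_isUnit h1 z (hz.trans ?_)⟩
  simp only [AddSubgroupClass.coe_sub, AddSubmonoidClass.coe_finsetSum, MulMemClass.coe_mul, hx',
    Algebra.smul_def]
  rfl

theorem IsOKRelativeTo.exists_idealGE_le_pow (hν : ν.IsOKRelativeTo R) :
    ∃ b : ℝ, ∀ n : ℕ, idealGE hν.nonnegOn (b * n) ≤ IsLocalRing.maximalIdeal R ^ n := by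
  obtain ⟨v, hv⟩ := hν.exists_forall_mem_pow
  refine ⟨ν.emb v, fun n x hx => hv n x fun h0 => ?_⟩
  rw [emb_nsmul, mul_comm]
  exact mem_levelGE.1 (mem_idealGE.1 hx) _ rfl

/-- For `d = 0` all values vanish, and condition 3 with `n = 1` would put `1` in the maximal ideal.
-/
theorem IsOKRelativeTo.dim_ne_zero (hν : ν.IsOKRelativeTo R) : d ≠ 0 := by
  rintro rfl
  obtain ⟨v, hv⟩ := hν.exists_forall_mem_pow
  have h1 := hv 1 1 fun _ => by simp [emb]
  rw [pow_one] at h1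
  exact (Ideal.ne_top_iff_one _).1 (IsLocalRing.maximalIdeal.isMaximal R).ne_top h1

end OK

end LatticeValuation

/-! ### Algebra of `p`-families. -/

section PFamilyIdeals

variable {R : Type*} [CommRing R]

theorem Ideal.span_finset_pow_le {K : Ideal R} {q : ℕ} (hq : q ≠ 0) (X : Finset R)
    (hX : ∀ x ∈ X, x ^ q ∈ K) : Ideal.span (X : Set R) ^ ((X.card + 1) * q) ≤ K := by
  classical
  induction X using Finset.induction_on with
  -- The extra `q` in the exponent serves this case: the zero ideal needs a positive power to be
  -- zero.
  | empty => simp [hq]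
  | insert a X ha ih =>
    rw [Finset.coe_insert, Ideal.span_insert, Finset.card_insert_of_notMem ha, add_mul _ 1,
      one_mul, add_comm]
    refine Ideal.sup_pow_add_le_pow_sup_pow.trans (sup_le ?_ ?_)
    · rw [Ideal.span_singleton_pow, Ideal.span_singleton_le_iff_mem]
      exact hX a (Finset.mem_insert_self a X)
    · exact ih fun x hx => hX x (Finset.mem_insert_of_mem hx)

theorem IsPFamily.pow_mem {p : ℕ} {I : ℕ → Ideal R} (hI : IsPFamily p I) {e : ℕ} {x : R}
    (hx : x ∈ I e) : x ^ p ∈ I (e + 1) :=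
  hI e (Ideal.subset_span ⟨x, hx, rfl⟩)

theorem IsPFamily.pow_pow_mem {p : ℕ} {I : ℕ → Ideal R} (hI : IsPFamily p I) {x : R}
    (hx : x ∈ I 0) (e : ℕ) : x ^ p ^ e ∈ I e := by
  induction e with
  | zero => simpa using hx
  | succ e ih => rw [pow_succ, pow_mul]; exact hI.pow_mem ih

/-- If `X` generates a power `m ^ n` inside `I 0`, the `p ^ e`-th powers of its elements lie in `I
e`. The number of generators does not depend on `e`, so the exponent is linear in `p ^ e`. -/
theorem IsPFamily.exists_pow_le {p : ℕ} (hp : p ≠ 0) {I : ℕ → Ideal R} (hI : IsPFamily p I)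
    {m : Ideal R} [IsNoetherianRing R] (hm : m ≤ (I 0).radical) :
    ∃ c : ℕ, ∀ e, m ^ (c * p ^ e) ≤ I e := by
  obtain ⟨n, hn⟩ := Ideal.exists_pow_le_of_le_radical_of_fg hm (IsNoetherian.noetherian m)
  obtain ⟨X, hX⟩ := IsNoetherian.noetherian (m ^ n)
  refine ⟨n * (X.card + 1), fun e => ?_⟩
  rw [mul_assoc, pow_mul, ← hX]
  refine Ideal.span_finset_pow_le (pow_ne_zero e hp) X fun x hx => hI.pow_pow_mem (hn ?_) e
  rw [← hX]
  exact Ideal.subset_span hx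

/-- In characteristic `p` the Frobenius is a ring homomorphism, so extension along it commutes with
products of ideals. -/
theorem IsPFamily.mul {p : ℕ} [Fact p.Prime] [CharP R p] {I J L : ℕ → Ideal R}
    (hI : IsPFamily p I) (hJ : IsPFamily p J) (hL : ∀ e, L e = I e * J e) : IsPFamily p L := by
  intro e
  rw [Ideal.span_le]
  rintro _ ⟨x, hx, rfl⟩
  have h1 : ∀ K : ℕ → Ideal R, IsPFamily p K → (K e).map (frobenius R p) ≤ K (e + 1) :=
    fun K hK => Ideal.map_le_iff_le_comap.2 fun y hy => hK.pow_mem hy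
  have h2 : frobenius R p x ∈ (I e * J e).map (frobenius R p) :=
    Ideal.mem_map_of_mem _ (hL e ▸ hx)
  rw [Ideal.map_mul] at h2
  rw [hL]
  exact Ideal.mul_mono (h1 I hI) (h1 J hJ) h2

theorem IsMaximalIdealPrimary.mul [IsLocalRing R] {I J : Ideal R} (hI : IsMaximalIdealPrimary I)
    (hJ : IsMaximalIdealPrimary J) : IsMaximalIdealPrimary (I * J) := by
  have h : (I * J).radical = IsLocalRing.maximalIdeal R := by
    rw [Ideal.radical_mul, hI.2, hJ.2, inf_idem]
  exact ⟨Ideal.isPrimary_of_isMaximal_radical (h ▸ IsLocalRing.maximalIdeal.isMaximal R), h⟩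

end PFamilyIdeals

/-! ### Volumes of `p`-families and the inequality. -/

namespace LatticeValuation

open MeasureTheory

variable {F : Type*} [Field F] {d : ℕ} {ν : LatticeValuation F d}
  {R : Type*} [CommRing R] [IsLocalRing R] [Algebra R F]

/-- The cone generated by the values of the nonzero elements of `R`. -/
noncomputable abbrev valueHull (ν : LatticeValuation F d) (R : Type*) [CommRing R] [Algebra R F] :
    PointedCone ℝ (Fin d → ℝ) :=
  PointedCone.hull ℝ (latticeCast d '' (ν.valueMonoid R))

theorem IsOKRelativeTo.dotProduct_pos (hν : ν.IsOKRelativeTo R) :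
    ∀ x ∈ closure (ν.valueHull R : Set (Fin d → ℝ)), x ≠ 0 → 0 < ν.weight ⬝ᵥ x := by
  intro x hx hx0
  refine hν.pointed x ?_ hx0
  rw [valueCone, valueSet_eq_image]
  exact hx

/-- Pointedness bounds the norm of a value by a multiple of its weight. -/
theorem IsOKRelativeTo.finite_emb_lt (hν : ν.IsOKRelativeTo R) (s : ℝ) :
    {u | u ∈ ν.valueMonoid R ∧ ν.emb u < s}.Finite := by
  obtain ⟨κ, hκ, h⟩ := exists_norm_le_mul_dotProduct (ν.valueHull R) ν.weight hν.dotProduct_pos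
  refine (finite_norm_latticeCast_le (κ * s)).subset fun u hu => ?_
  exact (h _ (Submodule.subset_span ⟨u, hu.1, rfl⟩)).trans (mul_le_mul_of_nonneg_left hu.2.le hκ)

theorem IsOKRelativeTo.exists_idealGE_le [IsNoetherianRing R] (hν : ν.IsOKRelativeTo R) {p : ℕ} (hp : p ≠ 0)
    {I : ℕ → Ideal R} (hI : IsPFamily p I) (hIm : ∀ e, IsMaximalIdealPrimary (I e)) :
    ∃ b : ℝ, ∀ e : ℕ, idealGE hν.nonnegOn (b * (p : ℝ) ^ e) ≤ I e := by
  obtain ⟨c, hc⟩ := hI.exists_pow_le hp (hIm 0).2.ge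
  obtain ⟨b, hb⟩ := hν.exists_idealGE_le_pow
  refine ⟨b * c, fun e => le_trans ?_ (hc e)⟩
  have := hb (c * p ^ e)
  push_cast at this
  rwa [← mul_assoc] at this

/-- The volume of a `p`-family is a multiple of the volume of the complement of its body. -/
theorem IsOKRelativeTo.tendsto_length_div [IsDomain R] [IsNoetherianRing R] [IsFractionRing R F]
    (hν : ν.IsOKRelativeTo R) {p : ℕ} (hp : 1 < p)
    {I : ℕ → Ideal R} (hI : IsPFamily p I) (hIm : ∀ e, IsMaximalIdealPrimary (I e)) :
    Bornology.IsBounded (pCobody (ν.valueHull R) p fun e => ν.valSet (I e)) ∧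
    Tendsto (fun e : ℕ => ((Module.length R (R ⧸ I e) : ℕ∞) : ℝ≥0∞) / ((p : ℝ≥0∞) ^ e) ^ d)
      atTop (𝓝 (((Module.length R (ResidueModule hν.nonnegOn) : ℕ∞) : ℝ≥0∞) *
        volume (pCobody (ν.valueHull R) p fun e => ν.valSet (I e)))) := by
  obtain ⟨b, hb⟩ := hν.exists_idealGE_le (by omega) hI hIm
  obtain ⟨w, hw⟩ := exists_shift hν.residueFinite
  have hS := ν.closure_valueMonoid R
  have hN := length_residueModule_ne_top hν.residueFinite fun x hx => hν.mem_levelGT hx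
  refine ⟨isBounded_pCobody hS hp ν.weight hν.dotProduct_pos (b := b) fun e u hu hlt =>
    mem_valSet_of_mem_valueMonoid (hb e) hu hlt.le, ?_⟩
  simp only [length_quotient_eq_tsum_gap hν.nonnegOn (hb _) (hν.finite_emb_lt _)]
  refine tendsto_tsum_div_volume_pCobody hS hp (T := fun e => ν.valSet (I e)) ?_ ?_ ν.weight
    hν.dotProduct_pos (G := fun e u => ((gap hν.nonnegOn (I e) u : ℕ∞) : ℝ≥0∞)) ?_ ?_ ?_
    (b := b) ?_ w ?_ ?_
  · intro e t ht s hs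
    simpa using add_mem_valSet_mul ht hs
  · exact fun e t ht => nsmul_mem_valSet (fun x hx => hI.pow_mem hx) ht
  · simpa using hN
  · exact fun e u => ENat.toENNReal_mono (gap_le_length_residueModule _ _ _)
  · intro e u hne
    by_contra hu
    exact hne (by simp [gap_eq_zero_of_notMem (I e) hu])
  · intro e u hne
    by_contra! hlt
    exact hne (by simp [gap_eq_zero_of_le (hb e) (u := u) hlt.le])
  · intro e u hu
    have : gap hν.nonnegOn (I e) u = 0 := gap_eq_zero fun x hx => by
      obtain ⟨z, hz, hxz⟩ := hw (I e) u hu _ hx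
      rw [Algebra.linearMap_apply, ← map_sub] at hxz
      exact Submodule.mem_sup.2 ⟨z, hz, x - z, hxz, by ring⟩
    simp [this]
  · intro e u hu huI
    have : gap hν.nonnegOn (I e) u = _ := gap_eq_length_residueModule huI fun ξ hξ =>
      (hw ⊤ u hu ξ hξ).imp fun z hz => hz.2
    simp only [this]

end LatticeValuation

theorem mainTheorem5 {R : Type*} [CommRing R] [IsDomain R] [IsLocalRing R] [IsNoetherianRing R]
    (p : ℕ) [Fact p.Prime] [CharP R p] (d : ℕ) (hdim : ringKrullDim R = d)
    (hOK : IsOKLocalDomain R)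
    (I J L : ℕ → Ideal R)
    (hI : IsPFamily p I) (hIm : ∀ e, IsMaximalIdealPrimary (I e))
    (hJ : IsPFamily p J) (hJm : ∀ e, IsMaximalIdealPrimary (J e))
    (hL : ∀ e, L e = I e * J e) :
    IsPFamily p L ∧ (∀ e, IsMaximalIdealPrimary (L e)) ∧
      ∃ volI volJ volL : ℝ≥0,
        HasPVolume p d I volI ∧ HasPVolume p d J volJ ∧ HasPVolume p d L volL ∧
          volL ^ (1 / (d : ℝ)) ≤ volI ^ (1 / (d : ℝ)) + volJ ^ (1 / (d : ℝ)) := by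
  have hLp : IsPFamily p L := hI.mul hJ hL
  have hLm : ∀ e, IsMaximalIdealPrimary (L e) := fun e => hL e ▸ (hIm e).mul (hJm e)
  refine ⟨hLp, hLm, ?_⟩
  obtain ⟨d', hd', ν, hν⟩ := hOK
  obtain rfl : d' = d := by
    rw [hdim] at hd'
    exact_mod_cast hd'.symm
  have hp : 1 < p := (Fact.out : p.Prime).one_lt
  have : NeZero d' := ⟨hν.dim_ne_zero⟩
  obtain ⟨hbI, hlimI⟩ := hν.tendsto_length_div hp hI hIm
  obtain ⟨hbJ, hlimJ⟩ := hν.tendsto_length_div hp hJ hJm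
  obtain ⟨hbL, hlimL⟩ := hν.tendsto_length_div hp hLp hLm
  set N : ℝ≥0∞ :=
    ((Module.length R (LatticeValuation.ResidueModule hν.nonnegOn) : ℕ∞) : ℝ≥0∞) with hN
  have hNt : N ≠ ∞ := by
    simpa [hN] using LatticeValuation.length_residueModule_ne_top hν.residueFinite
      fun x hx => hν.mem_levelGT hx
  have hineq := volume_pCobody_rpow_le (K := ν.valueHull R) (p := p) (by omega)
    (T₁ := fun e => ν.valSet (I e)) (T₂ := fun e => ν.valSet (J e))
    (T₃ := fun e => ν.valSet (L e))
    (fun e t ht => LatticeValuation.nsmul_mem_valSet (fun x hx => hI.pow_mem hx) ht)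
    (fun e t ht => LatticeValuation.nsmul_mem_valSet (fun x hx => hJ.pow_mem hx) ht)
    (fun e t ht s hs => by
      simp only [hL]
      exact LatticeValuation.add_mem_valSet_mul ht hs) hbI hbJ hbL
  have hexp : (0 : ℝ) ≤ 1 / (d' : ℝ) := by positivity
  -- The factor `N ^ (1 / d)` turns volumes of complements into volumes of families.
  have hineqN := mul_le_mul_right hineq (N ^ (1 / (d' : ℝ)))
  rw [mul_add] at hineqN
  simp only [← ENNReal.mul_rpow_of_nonneg _ _ hexp] at hineqN
  have hfin : ∀ {D : Set (Fin d' → ℝ)}, Bornology.IsBounded D → N * MeasureTheory.volume D ≠ ∞ :=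
    fun hD => ENNReal.mul_ne_top hNt hD.measure_lt_top.ne
  have hvol : ∀ {K : ℕ → Ideal R} {v : ℝ≥0∞}, v ≠ ∞ →
      Tendsto (fun e : ℕ => ((Module.length R (R ⧸ K e) : ℕ∞) : ℝ≥0∞) / ((p : ℝ≥0∞) ^ e) ^ d')
        atTop (𝓝 v) → HasPVolume p d' K v.toNNReal := fun hv h => by
    rwa [HasPVolume, ENNReal.coe_toNNReal hv]
  refine ⟨_, _, _, hvol (hfin hbI) hlimI, hvol (hfin hbJ) hlimJ, hvol (hfin hbL) hlimL, ?_⟩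
  rw [← ENNReal.coe_toNNReal (hfin hbI), ← ENNReal.coe_toNNReal (hfin hbJ),
    ← ENNReal.coe_toNNReal (hfin hbL)] at hineqN
  simp only [← ENNReal.coe_rpow_of_nonneg _ hexp] at hineqN
  exact_mod_cast hineqN
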